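/- Let $K$ be an algebraically closed field of characteristic $p>0$, and let $d\ge 1$, $n\ge d+1$ and $k\ge 2$ be integers with $\gcd(k,p)=1$. For $\rho\in K^{d+1}\setminus\{0\}$ let $\Sigma(\rho)=\{\rho_1x_1+\cdots+\rho_{d+1}x_{d+1}=0\}\subset\mathbb P^d_K$. A finite family of hyperplanes of $\mathbb P^d_K$ is in general position if the hyperplanes are pairwise different and any $s$ of them with $3\le s\le d+1$ intersect in a plane of dimension $d-s$ (the empty set if $s=d+1$). Let $\Lambda=(\lambda_1,\ldots,\lambda_d)$ with $\lambda_j=(\lambda_{1,j},\ldots,\lambda_{n-d-1,j})\in K^{n-d-1}$, and suppose that $\Lambda\in X_{n,d}$, that is, the $n+1$ hyperplanes $\Sigma(e_1),\ldots,\Sigma(e_{d+1})$ (with $e_1,\ldots,e_{d+1}$ the standard basis of $K^{d+1}$), $\Sigma(1,\ldots,1)$ and $\Sigma(\lambda_{i,1},\ldots,\lambda_{i,d},1)$, $1\le i\le n-d-1$, are in general position. Put $\lambda_{0,j}=1$ for $1\le j\le d$ and $$f_i=\lambda_{i,1}x_1^k+\cdots+\lambda_{i,d}x_d^k+x_{d+1}^k+x_{d+2+i}^k\in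 K[x_1,\ldots,x_{n+1}],\qquad 0\le i\le n-d-1 .$$ Theorem. The closed subset $X^k_n(\Lambda)=\{f_0=\cdots=f_{n-d-1}=0\}\subset\mathbb P^n_K$ is irreducible, nonsingular (all its local rings are regular), of dimension $d$, and it is the complete intersection of the $n-d$ hypersurfaces $f_i=0$; that is, its homogeneous ideal is generated by the $n-d=\operatorname{codim} X^k_n(\Lambda)$ polynomials $f_0,\ldots,f_{n-d-1}$. -/

import Mathlib

noncomputable section

namespace GeneralizedFermat

/-! ### Closed subsets of projective space -/

section ProjectiveSpace

variable (n : ℕ) (K : Type*) [Field K]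

/-- The standard grading by degree of `K[x_1, …, x_{n+1}]`. -/
abbrev grading : ℕ → Submodule K (MvPolynomial (Fin (n + 1)) K) :=
  MvPolynomial.homogeneousSubmodule (Fin (n + 1)) K

instance gradingGradedAlgebra : GradedAlgebra (grading n K) := MvPolynomial.gradedAlgebra

/-- Projective `n`-space `ℙⁿ_K = Proj K[x_1, …, x_{n+1}]` with its Zariski topology: its points are
the homogeneous prime ideals that do not contain the irrelevant ideal. -/
abbrev ProjSpace : Type _ := ProjectiveSpectrum (grading n K)

variable {n K}

/-- The local ring `𝒪_{X,x} = 𝒪_{ℙⁿ,x} / (I_X)_x` of a closed subset `X ⊆ ℙⁿ_K` (with its reduced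
structure) at a point `x`. Here `𝒪_{ℙⁿ,x}` is the degree zero part of the localization of
`K[x_1, …, x_{n+1}]` at the homogeneous prime `x`, and `(I_X)_x` is the degree zero part of the
extension to that localization of the homogeneous ideal `I(X)` of `X`. -/
abbrev LocalRing (X : Set (ProjSpace n K)) (x : ProjSpace n K) : Type _ :=
  HomogeneousLocalization.AtPrime (grading n K) x.asHomogeneousIdeal.toIdeal ⧸
    Ideal.comap
      (algebraMap (HomogeneousLocalization.AtPrime (grading n K) x.asHomogeneousIdeal.toIdeal)
        (Localization.AtPrime x.asHomogeneousIdeal.toIdeal))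
      (Ideal.map
        (algebraMap (MvPolynomial (Fin (n + 1)) K)
          (Localization.AtPrime x.asHomogeneousIdeal.toIdeal))
        (ProjectiveSpectrum.vanishingIdeal X).toIdeal)

/-- A closed subset of projective space is nonsingular if all its local rings are regular. -/
def IsNonsingular (X : Set (ProjSpace n K)) : Prop :=
  ∀ x ∈ X, IsRegularLocalRing (LocalRing X x)

/-- `X ⊆ ℙⁿ_K` is the (strict) complete intersection of the hypersurfaces `g_i = 0`: the `g_i` are
homogeneous polynomials which generate the full homogeneous ideal `I(X)`, and their number is the
codimension of `X`. -/
def IsCompleteIntersectionOf {ι : Type*} [Fintype ι] (X : Set (ProjSpace n K))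
    (g : ι → MvPolynomial (Fin (n + 1)) K) : Prop :=
  (∀ i, ∃ m, (g i).IsHomogeneous m) ∧
    (ProjectiveSpectrum.vanishingIdeal X).toIdeal = Ideal.span (Set.range g) ∧
    topologicalKrullDim X + (Fintype.card ι : WithBot ℕ∞) = n

end ProjectiveSpace

/-! ### Hyperplanes in general position and the parameter space -/

section Parameters

variable {K : Type*} [Field K]

/-- The linear subspace of `K^{d+1}` whose projectivization is the hyperplane
`ρ_1 x_1 + ⋯ + ρ_{d+1} x_{d+1} = 0` of `ℙ^d_K`. -/
def hyperplane {d : ℕ} (ρ : Fin (d + 1) → K) : Submodule K (Fin (d + 1) → K) :=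
  LinearMap.ker (∑ i, ρ i • (LinearMap.proj i : (Fin (d + 1) → K) →ₗ[K] K))

/-- The hyperplanes with coefficient vectors `ρ_j` are in general position: they are pairwise
different, and any `s` of them with `3 ≤ s ≤ d + 1` meet in a plane of projective dimension `d - s`
(that is, in a linear subspace of dimension `d + 1 - s`; for `s = d + 1` this is the empty set). -/
def InGeneralPosition {d : ℕ} {ι : Type*} (ρ : ι → Fin (d + 1) → K) : Prop :=
  (∀ j, ρ j ≠ 0) ∧
    Function.Injective (fun j => hyperplane (ρ j)) ∧
    ∀ s : Finset ι, 3 ≤ s.card → s.card ≤ d + 1 →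
      Module.finrank K (⨅ j ∈ s, hyperplane (ρ j) : Submodule K (Fin (d + 1) → K)) + s.card = d + 1

variable {d n : ℕ}

/-- The vectors `(1, …, 1, 1)` (for `i = 0`) and `(λ_{i,1}, …, λ_{i,d}, 1)` (for
`i = 1, …, n - d - 1`), where `λ_{i,j}` is entry `i` of the `j`-th component of `Λ`. -/
def coeffRow (Λ : Fin d → Fin (n - d - 1) → K) (i : Fin (n - d)) : Fin (d + 1) → K :=
  if h : 0 < (i : ℕ) then
    Fin.snoc (α := fun _ => K) (fun j : Fin d => Λ j ⟨(i : ℕ) - 1, by omega⟩) 1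
  else fun _ => 1

/-- Coefficient vectors of the `n + 1` hyperplanes `Σ_1(Λ), …, Σ_{n+1}(Λ)` of `ℙ^d_K`: first the
`d + 1` standard basis vectors, then `(1, …, 1)`, then `(λ_{i,1}, …, λ_{i,d}, 1)`. -/
def hyperplaneCoeff (Λ : Fin d → Fin (n - d - 1) → K) (j : Fin (n + 1)) : Fin (d + 1) → K :=
  if h : (j : ℕ) < d + 1 then Pi.single ⟨j, h⟩ 1
  else coeffRow (n := n) Λ ⟨(j : ℕ) - (d + 1), by omega⟩

variable (K d n) in
/-- The parameter space `X_{n,d} ⊆ (K^{n-d-1})^d`. -/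
def parameterSpace : Set (Fin d → Fin (n - d - 1) → K) :=
  {Λ | InGeneralPosition (hyperplaneCoeff (n := n) Λ)}

/-! ### The generalized Fermat varieties -/

/-- The polynomials `λ_{i,1} x_1^k + ⋯ + λ_{i,d} x_d^k + x_{d+1}^k + x_{d+2+i}^k` for
`i = 0, …, n - d - 1`, with `λ_{0,j} = 1`. (Here `x_1, …, x_{n+1}` are the variables with indices
`0, …, n`.) -/
def fermatEquation (k : ℕ) (Λ : Fin d → Fin (n - d - 1) → K) (i : Fin (n - d)) :
    MvPolynomial (Fin (n + 1)) K :=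
  (∑ j : Fin (d + 1),
      MvPolynomial.C (coeffRow Λ i j) * MvPolynomial.X ⟨(j : ℕ), by have := i.isLt; omega⟩ ^ k) +
    MvPolynomial.X ⟨d + 1 + (i : ℕ), by omega⟩ ^ k

/-- `X^k_n(Λ) ⊆ ℙⁿ_K`, the common zero locus of the `n - d` Fermat equations. -/
def fermatVariety (k : ℕ) (Λ : Fin d → Fin (n - d - 1) → K) : Set (ProjSpace n K) :=
  ProjectiveSpectrum.zeroLocus (grading n K) (Set.range (fermatEquation (n := n) k Λ))

end Parameters

end GeneralizedFermat

end

-- On the variety every coordinate satisfies `x_j^k = ℓ_j(x_1^k, …, x_{d+1}^k)` for a linear form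
-- `ℓ_j`, which is the variable itself for the first `d + 1` indices and otherwise minus the form of
-- the corresponding hyperplane. So the cone is a Kummer cover of affine space with coordinates `t_i
-- = x_i^k`, and everything follows from a generic point of this cover.
--
-- Let `F = K(t)` and let `z_j` be a `k`-th root of `ℓ_j(t)` in a separable closure of `F`; it
-- exists because `k` is invertible. As `K` contains the `k`-th roots of unity, Galois acts on each
-- monomial in the `z_j` by a character. The `ℓ_j` are pairwise non-proportional primes, so unique
-- factorization makes these characters distinct for exponents `< k`, and Dedekind's theorem makes
-- the monomials independent (`linearIndependent_root_monomials`). Modulo the Fermat ideal `I` every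
-- polynomial is a combination of such monomials over `K[t]`. Hence `I` is exactly the ideal of
-- relations between the `z_j` (`exists_generic_point`), so it is prime and homogeneous. This gives
-- irreducibility and `I(X) = I`.
--
-- The quotient by `I` is integral over `K[t]`, so incomparability bounds the dimension above by
-- `d`, and going up along a flag of coordinate ideals bounds it below.
--
-- For regularity, any `d + 1` of the forms `ℓ_j` are a basis, so at most `d` coordinates vanish at
-- a point. Complete these to `d + 1` coordinates, one of them nonzero at the point, and divide by
-- that one: the ratios generate a polynomial ring `T`. The local ring is a localization of a domain
-- generated over `T` by elements of `T` and by units with `k`-th power in `T`. It is unramified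
-- over `T`, and together with going down this makes it regular (`isRegularLocalRing_germs`).

universe u v

namespace GeneralizedFermat

open MvPolynomial

/-! ### Kummer theory -/

section Kummer

variable {F E : Type*} [Field F] [Field E] [Algebra F E]

/-- The character `σ ↦ σ(w)/w` of the Galois group attached to a nonzero element `w` on which the
Galois group acts through scalars in the base field. -/
noncomputable def kummerCharacter (w : E) (hw : w ≠ 0) (h : ∀ σ τ : Gal(E/F), τ (σ w / w) = σ w / w) :
    Gal(E/F) →* E where
  toFun σ := σ w / w
  map_one' := by simp [hw]
  map_mul' σ τ := by
    have h1 := h τ σ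
    rw [map_div₀, div_eq_iff (by simpa using hw)] at h1
    rw [AlgEquiv.mul_apply, h1, mul_div_assoc, mul_comm]

/-- Nonzero eigenvectors of the Galois group, no two of which have their ratio in the base field,
are linearly independent over the base field. -/
theorem linearIndependent_of_kummer [IsGalois F E] {α : Type*} (w : α → E) (hw : ∀ a, w a ≠ 0)
    (h : ∀ a, ∀ σ τ : Gal(E/F), τ (σ (w a) / w a) = σ (w a) / w a)
    (hne : ∀ a b, (∃ c : F, algebraMap F E c = w a / w b) → a = b) :
    LinearIndependent F w := by
  let χ : α → (Gal(E/F) →* E) := fun a => kummerCharacter (w a) (hw a) (h a)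
  have hχ : Function.Injective χ := by
    intro a b hab
    refine hne a b ?_
    -- Equal characters make the ratio Galois invariant, so it lies in `F`.
    have : w a / w b ∈ (⊥ : IntermediateField F E) := by
      rw [InfiniteGalois.mem_bot_iff_fixed]
      intro σ
      have h1 : σ (w a) / w a = σ (w b) / w b := DFunLike.congr_fun hab σ
      rw [div_eq_div_iff (hw a) (hw b)] at h1
      rw [map_div₀, div_eq_div_iff (by simpa using hw b) (hw b), h1, mul_comm]
    exact IntermediateField.mem_bot.mp this
  have hli := (linearIndependent_monoidHom Gal(E/F) E).comp χ hχ
  rw [linearIndependent_iff'] at hli ⊢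
  intro s g hg a ha
  -- Applying `σ` to `∑ g_a w_a = 0` gives `∑ (g_a w_a) χ_a(σ) = 0`, a relation between distinct
  -- characters.
  have := hli s (fun a => algebraMap F E (g a) * w a) ?_ a ha
  · simpa [hw a] using this
  · ext σ
    have h2 := congrArg σ hg
    rw [map_zero, map_sum] at h2
    simp only [Finset.sum_apply, Pi.smul_apply, Pi.zero_apply, Function.comp_apply, smul_eq_mul]
    rw [← h2]
    refine Finset.sum_congr rfl fun b _ => ?_
    change algebraMap F E (g b) * w b * (σ (w b) / w b) = _
    rw [Algebra.smul_def, map_mul, AlgEquiv.commutes, mul_assoc, mul_div_cancel₀ _ (hw b)]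

/-- If `w ^ k` lies in the base field, which contains an algebraically closed field, then the Galois
group acts on `w` through scalars in the base field. -/
theorem galois_ratio_fixed (K : Type*) [Field K] [IsAlgClosed K] [Algebra K F] [Algebra K E]
    [IsScalarTower K F E] {k : ℕ} (hk : k ≠ 0) {w : E} (hw : w ≠ 0) {c : F}
    (hc : w ^ k = algebraMap F E c) (σ τ : Gal(E/F)) : τ (σ w / w) = σ w / w := by
  have h1 : (σ w / w) ^ k = 1 := by
    rw [div_pow, ← map_pow, hc, AlgEquiv.commutes, ← hc, div_self (pow_ne_zero _ hw)]
  -- All `k`-th roots of unity of `E` come from `K`, hence are fixed by Galois.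
  have h2 : (Polynomial.X ^ k - 1 : Polynomial K).Splits := IsAlgClosed.splits _
  have h3 : (Polynomial.X ^ k - 1 : Polynomial K) ≠ 0 :=
    Polynomial.X_pow_sub_C_ne_zero (Nat.pos_of_ne_zero hk) 1
  obtain ⟨y, hy⟩ := h2.mem_range_of_isRoot (i := algebraMap K E) h3
    (x := σ w / w) (by simp [h1])
  rw [← hy, IsScalarTower.algebraMap_apply K F E, AlgEquiv.commutes]

end Kummer

/-! ### Linear forms -/

section LinForm

variable {K : Type*} [Field K] {τ : Type*} [Fintype τ]

/-- The linear form with coefficient vector `c`. -/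
noncomputable def linForm (c : τ → K) : MvPolynomial τ K := ∑ i, C (c i) * X i

theorem linForm_eq_sumSMulX (c : τ → K) :
    linForm c = MvPolynomial.sumSMulX (Finsupp.equivFunOnFinite.symm c) := by
  simp [linForm, MvPolynomial.sumSMulX, Finsupp.linearCombination_apply, Finsupp.sum_fintype,
    MvPolynomial.smul_eq_C_mul]

theorem linForm_coeff (c : τ → K) (i : τ) : (linForm c).coeff (Finsupp.single i 1) = c i := by
  rw [linForm_eq_sumSMulX, MvPolynomial.coeff_sumSMulX]; rfl

theorem linForm_injective : Function.Injective (linForm : (τ → K) → MvPolynomial τ K) := by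
  intro a b h; ext i; rw [← linForm_coeff a, h, linForm_coeff]

theorem linForm_zero : linForm (0 : τ → K) = 0 := by simp [linForm]

theorem linForm_smul (a : K) (c : τ → K) : linForm (a • c) = C a * linForm c := by
  simp [linForm, Finset.mul_sum, mul_assoc]

theorem linForm_add (a c : τ → K) : linForm (a + c) = linForm a + linForm c := by
  simp [linForm, Finset.sum_add_distrib, add_mul]

theorem linForm_single [DecidableEq τ] (i : τ) : linForm (Pi.single i (1 : K)) = X i := by
  simp [linForm, Pi.single_apply]

theorem linForm_prime {c : τ → K} (hc : c ≠ 0) : Prime (linForm c) := by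
  rw [linForm_eq_sumSMulX]
  obtain ⟨i, hi⟩ := Function.ne_iff.mp hc
  refine (MvPolynomial.irreducible_sumSMulX _ ⟨i, by simpa using hi⟩ fun r hr => ?_).prime
  have := hr i
  refine isUnit_iff_ne_zero.mpr ?_
  rintro rfl
  exact hi (by simpa using this)

theorem linForm_isHomogeneous (c : τ → K) : (linForm c).IsHomogeneous 1 :=
  IsHomogeneous.sum _ _ _ fun i _ => by
    simpa using (isHomogeneous_C τ (c i)).mul (isHomogeneous_X K i)

/-- Both forms have degree one, so the cofactor is a constant. -/
theorem linForm_dvd {a b : τ → K} (hb : b ≠ 0) (h : linForm a ∣ linForm b) :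
    ∃ c : K, b = c • a := by
  have ha : a ≠ 0 := by
    rintro rfl
    rw [linForm_zero, zero_dvd_iff, ← linForm_zero] at h
    exact hb (linForm_injective h)
  obtain ⟨g, hg⟩ := h
  have h0 := (linForm_prime hb).ne_zero
  have hd : ∀ {c : τ → K}, c ≠ 0 → (linForm c).totalDegree = 1 := fun hc =>
    (linForm_isHomogeneous _).totalDegree (linForm_prime hc).ne_zero
  have hg0 : g ≠ 0 := by rintro rfl; simp [h0] at hg
  have := congrArg totalDegree hg
  rw [totalDegree_mul_of_isDomain (linForm_prime ha).ne_zero hg0, hd ha, hd hb] at this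
  have hgC := (totalDegree_eq_zero_iff_eq_C (p := g)).mp (by omega)
  refine ⟨g.coeff 0, linForm_injective ?_⟩
  rw [linForm_smul, ← hgC, hg, mul_comm]

end LinForm

/-! ### Roots of linear forms -/

section Roots

variable {K : Type*} [Field K] {τ ι : Type*} [Fintype τ] [Fintype ι]

/-- A monomial identity `u^k ∏ ℓ_j^{a_j} = v^k ∏ ℓ_j^{b_j}` with `a_j, b_j < k` forces `a = b`. -/
theorem exponents_eq {ρ : ι → τ → K} (h0 : ∀ j, ρ j ≠ 0)
    (hρ : ∀ i j, ∀ c : K, ρ j = c • ρ i → i = j) {k : ℕ} {u v : MvPolynomial τ K}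
    (hu : u ≠ 0) (hv : v ≠ 0) (a b : ι → Fin k)
    (h : u ^ k * ∏ j, linForm (ρ j) ^ (a j : ℕ) = v ^ k * ∏ j, linForm (ρ j) ^ (b j : ℕ)) :
    a = b := by
  classical
  ext j
  have hp := linForm_prime (h0 j)
  have key : ∀ (e : ι → Fin k),
      emultiplicity (linForm (ρ j)) (∏ i, linForm (ρ i) ^ (e i : ℕ)) = (e j : ℕ) := by
    intro e
    rw [Finset.emultiplicity_prod hp, Finset.sum_eq_single j]
    · rw [emultiplicity_pow hp]
      have : emultiplicity (linForm (ρ j)) (linForm (ρ j)) = 1 :=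
        (FiniteMultiplicity.of_prime_left hp hp.ne_zero).emultiplicity_self
      rw [this, mul_one]
    · intro i _ hij
      rw [emultiplicity_pow hp, emultiplicity_eq_zero.mpr, mul_zero]
      intro hd
      obtain ⟨c, hc⟩ := linForm_dvd (h0 i) hd
      exact hij (hρ j i c hc).symm
    · simp
  have h1 := congrArg (emultiplicity (linForm (ρ j))) h
  rw [emultiplicity_mul hp, emultiplicity_mul hp, key, key, emultiplicity_pow hp,
    emultiplicity_pow hp, (FiniteMultiplicity.of_prime_left hp hu).emultiplicity_eq_multiplicity,
    (FiniteMultiplicity.of_prime_left hp hv).emultiplicity_eq_multiplicity] at h1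
  generalize multiplicity (linForm (ρ j)) u = m at h1
  generalize multiplicity (linForm (ρ j)) v = m' at h1
  have h2 : k * m + (a j : ℕ) = k * m' + (b j : ℕ) := by exact_mod_cast h1
  -- The unknown `k`-th powers contribute multiples of `k`; the exponents are the remainders.
  have h3 := congrArg (· % k) h2
  simpa [Nat.mul_add_mod, Nat.mod_eq_of_lt] using h3

/-- The monomials of exponents `< k` in `k`-th roots of pairwise non-proportional linear forms are
linearly independent over the field of rational functions. -/
theorem linearIndependent_root_monomials [IsAlgClosed K] {E : Type*} [Field E]
    [Algebra (FractionRing (MvPolynomial τ K)) E]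
    [IsGalois (FractionRing (MvPolynomial τ K)) E] {ρ : ι → τ → K} (h0 : ∀ j, ρ j ≠ 0)
    (hρ : ∀ i j, ∀ c : K, ρ j = c • ρ i → i = j) {k : ℕ} (hk : k ≠ 0) (z : ι → E)
    (hz : ∀ j, z j ^ k = algebraMap (FractionRing (MvPolynomial τ K)) E
      (algebraMap _ _ (linForm (ρ j)))) :
    LinearIndependent (FractionRing (MvPolynomial τ K))
      (fun e : ι → Fin k => ∏ j, z j ^ (e j : ℕ)) := by
  let S := MvPolynomial τ K
  let F := FractionRing S
  let _ : Algebra K E := ((algebraMap F E).comp (algebraMap K F)).toAlgebra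
  have : IsScalarTower K F E := IsScalarTower.of_algebraMap_eq fun _ => rfl
  have hz0 : ∀ j, z j ≠ 0 := by
    intro j hj
    have := hz j
    rw [hj, zero_pow hk, eq_comm, map_eq_zero,
      map_eq_zero_iff _ (IsFractionRing.injective S F)] at this
    exact (linForm_prime (h0 j)).ne_zero this
  have hpow : ∀ e : ι → Fin k, (∏ j, z j ^ (e j : ℕ)) ^ k =
      algebraMap F E (algebraMap S F (∏ j, linForm (ρ j) ^ (e j : ℕ))) := by
    intro e
    rw [← Finset.prod_pow, map_prod, map_prod]
    exact Finset.prod_congr rfl fun j _ => by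
      rw [← pow_mul, mul_comm, pow_mul, hz, map_pow, map_pow]
  have hne : ∀ e : ι → Fin k, ∏ j, z j ^ (e j : ℕ) ≠ 0 := fun e =>
    Finset.prod_ne_zero_iff.mpr fun j _ => pow_ne_zero _ (hz0 j)
  refine linearIndependent_of_kummer _ hne
    (fun e σ τ => galois_ratio_fixed K hk (hne e) (hpow e) σ τ) ?_
  rintro a b ⟨c, hc⟩
  obtain ⟨u, v, hv, rfl⟩ := IsFractionRing.div_surjective (A := S) c
  have hv0 : v ≠ 0 := nonZeroDivisors.ne_zero hv
  have hSE : Function.Injective ((algebraMap F E).comp (algebraMap S F)) :=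
    (algebraMap F E).injective.comp (IsFractionRing.injective S F)
  have hv1 : algebraMap F E (algebraMap S F v) ≠ 0 := fun h => hv0 (hSE (by simpa using h))
  rw [map_div₀, div_eq_div_iff hv1 (hne b)] at hc
  have hu0 : u ≠ 0 := by
    rintro rfl
    rw [map_zero, map_zero, zero_mul] at hc
    exact mul_ne_zero (hne a) hv1 hc.symm
  refine exponents_eq h0 hρ hv0 hu0 a b (hSE ?_)
  -- Taking `k`-th powers turns the relation between roots into an identity of polynomials.
  have h2 := congrArg (· ^ k) hc
  simp only [mul_pow, hpow] at h2
  simp only [RingHom.comp_apply, map_mul, map_pow] at h2 ⊢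
  rw [h2, mul_comm]

end Roots

end GeneralizedFermat

namespace GeneralizedFermat

open MvPolynomial

/-! ### The ideal of a generalized Fermat variety is prime -/

section Prime

variable {K : Type*} [Field K] {τ ι : Type*} [Fintype τ] [Fintype ι]

/-- The substitution `t_i ↦ x_{s(i)}^k`. -/
noncomputable def powSubst (K : Type*) [Field K] (k : ℕ) (s : τ → ι) :
    MvPolynomial τ K →ₐ[K] MvPolynomial ι K :=
  aeval fun i => X (s i) ^ k

/-- Modulo an ideal containing the Fermat relations `x_j^k = ℓ_j(x_{s(1)}^k, …)`, every polynomial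
is a combination of the monomials with exponents `< k` with coefficients in `K[x_{s(i)}^k]`. -/
theorem exists_reduction [DecidableEq ι] {ρ : ι → τ → K} {k : ℕ} (hk : k ≠ 0) {s : τ → ι}
    {I : Ideal (MvPolynomial ι K)}
    (hI : ∀ j, X j ^ k - powSubst K k s (linForm (ρ j)) ∈ I) (f : MvPolynomial ι K) :
    ∃ h : (ι → Fin k) → MvPolynomial τ K,
      f - ∑ e, powSubst K k s (h e) * ∏ j, X j ^ (e j : ℕ) ∈ I := by
  have hk' : 0 < k := Nat.pos_of_ne_zero hk
  induction f using MvPolynomial.induction_on' with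
  | monomial m a =>
    -- Divide each exponent by `k`: the quotient becomes a power of `ℓ_j`, the remainder stays.
    let e₀ : ι → Fin k := fun j => ⟨m j % k, Nat.mod_lt _ hk'⟩
    refine ⟨Pi.single e₀ (C a * ∏ j, linForm (ρ j) ^ (m j / k)), ?_⟩
    rw [Finset.sum_eq_single e₀ (fun e _ he => by simp [he]) (by simp), ← Ideal.Quotient.eq]
    have hI' : ∀ j, Ideal.Quotient.mk I (powSubst K k s (linForm (ρ j))) =
        Ideal.Quotient.mk I (X j) ^ k := fun j => by
      rw [← map_pow, eq_comm, Ideal.Quotient.eq]; exact hI j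
    have hC : powSubst K k s (C a) = C a := by simp [powSubst, algebraMap_eq]
    rw [Pi.single_eq_same, monomial_eq, Finsupp.prod_fintype _ _ (by simp)]
    simp only [map_mul, map_prod, map_pow, hI', hC, mul_assoc, ← Finset.prod_mul_distrib]
    congr 1
    refine Finset.prod_congr rfl fun j _ => ?_
    rw [← pow_mul, ← pow_add, Nat.div_add_mod]
  | add p q hp hq =>
    obtain ⟨h1, hh1⟩ := hp
    obtain ⟨h2, hh2⟩ := hq
    refine ⟨h1 + h2, ?_⟩
    convert I.add_mem hh1 hh2 using 1
    simp only [Pi.add_apply, map_add, add_mul, Finset.sum_add_distrib]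
    ring

/-- At the generic point, the substitution `t_i ↦ x_{s(i)}^k` becomes the inclusion of `K[t]`. -/
theorem aeval_powSubst {ι : Type*} {E : Type*} [CommRing E] [Algebra K E]
    [Algebra (MvPolynomial τ K) E] [IsScalarTower K (MvPolynomial τ K) E]
    {ρ : ι → τ → K} {k : ℕ} {s : τ → ι} (hs : ∀ i, linForm (ρ (s i)) = X i) {z : ι → E}
    (hz : ∀ j, z j ^ k = algebraMap (MvPolynomial τ K) E (linForm (ρ j)))
    (g : MvPolynomial τ K) :
    aeval z (powSubst K k s g) = algebraMap (MvPolynomial τ K) E g := by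
  have hψ : (aeval z).comp (powSubst K k s) = IsScalarTower.toAlgHom K (MvPolynomial τ K) E := by
    refine MvPolynomial.algHom_ext fun i => ?_
    simp [powSubst, hz, hs]
  exact DFunLike.congr_fun hψ g

/-- If the monomials with exponents `< k` in the roots `z_j` are linearly independent, the Fermat
relations generate all algebraic relations between the `z_j`. -/
theorem mem_of_aeval_eq_zero [DecidableEq ι] {E : Type*} [CommRing E] [Algebra K E]
    [Algebra (MvPolynomial τ K) E] [IsScalarTower K (MvPolynomial τ K) E]
    {ρ : ι → τ → K} {k : ℕ} (hk : k ≠ 0) {s : τ → ι}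
    (hs : ∀ i, linForm (ρ (s i)) = X i) {I : Ideal (MvPolynomial ι K)}
    (hI : ∀ j, X j ^ k - powSubst K k s (linForm (ρ j)) ∈ I) {z : ι → E}
    (hz : ∀ j, z j ^ k = algebraMap (MvPolynomial τ K) E (linForm (ρ j)))
    (hli : LinearIndependent (MvPolynomial τ K) fun e : ι → Fin k => ∏ j, z j ^ (e j : ℕ))
    (hIz : ∀ f ∈ I, aeval z f = 0) {f : MvPolynomial ι K} (hf : aeval z f = 0) : f ∈ I := by
  obtain ⟨h, hh⟩ := exists_reduction hk hI f
  have h1 := hIz _ hh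
  rw [map_sub, hf, zero_sub, neg_eq_zero, map_sum] at h1
  simp only [map_mul, aeval_powSubst hs hz, map_prod, map_pow, aeval_X, ← Algebra.smul_def] at h1
  have h2 := Fintype.linearIndependent_iff.mp hli h h1
  simpa [h2] using hh

/-- The coordinate ring of a generalized Fermat variety is integral over `K[x_{s(i)}^k]`. -/
theorem isIntegral_powSubst {ι : Type*} {ρ : ι → τ → K} {k : ℕ} (hk : k ≠ 0) {s : τ → ι}
    {I : Ideal (MvPolynomial ι K)}
    (hI : ∀ j, X j ^ k - powSubst K k s (linForm (ρ j)) ∈ I) :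
    ((Ideal.Quotient.mk I).comp (powSubst K k s).toRingHom).IsIntegral := by
  let _ : Algebra (MvPolynomial τ K) (MvPolynomial ι K ⧸ I) :=
    ((Ideal.Quotient.mk I).comp (powSubst K k s).toRingHom).toAlgebra
  intro x
  obtain ⟨f, rfl⟩ := Ideal.Quotient.mk_surjective x
  change IsIntegral (MvPolynomial τ K) _
  induction f using MvPolynomial.induction_on with
  | C a =>
    convert isIntegral_algebraMap (R := MvPolynomial τ K) (x := C a)
    change _ = Ideal.Quotient.mk I (powSubst K k s (C a))
    simp [powSubst, algebraMap_eq]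
  | add p q hp hq => rw [map_add]; exact hp.add hq
  | mul_X p j hp =>
    rw [map_mul]
    refine hp.mul (IsIntegral.of_pow (Nat.pos_of_ne_zero hk) ?_)
    have h1 : Ideal.Quotient.mk I (X j) ^ k =
        algebraMap (MvPolynomial τ K) (MvPolynomial ι K ⧸ I) (linForm (ρ j)) := by
      rw [← map_pow]
      exact Ideal.Quotient.eq.mpr (hI j)
    rw [h1]
    exact isIntegral_algebraMap

/-- There is a generic point: a field `E` algebraic over `K(t)` with `k`-th roots `z_j` of the
linear forms `ℓ_j` such that the Fermat relations generate all relations between the `z_j`. -/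
theorem exists_generic_point {K : Type u} [Field K] [IsAlgClosed K] {τ : Type v} [Fintype τ]
    {ι : Type*} [Fintype ι] {ρ : ι → τ → K} (h0 : ∀ j, ρ j ≠ 0)
    (hρ : ∀ i j, ∀ c : K, ρ j = c • ρ i → i = j) {k : ℕ} (hk : (k : K) ≠ 0) {s : τ → ι}
    (hs : ∀ i, linForm (ρ (s i)) = X i) {I : Ideal (MvPolynomial ι K)}
    (hI : ∀ j, X j ^ k - powSubst K k s (linForm (ρ j)) ∈ I)
    (hI' : ∀ J : Ideal (MvPolynomial ι K),
      (∀ j, X j ^ k - powSubst K k s (linForm (ρ j)) ∈ J) → I ≤ J) :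
    ∃ (E : Type (max u v)) (_ : Field E) (_ : Algebra K E) (_ : Algebra (MvPolynomial τ K) E)
      (_ : IsScalarTower K (MvPolynomial τ K) E) (_ : FaithfulSMul (MvPolynomial τ K) E)
      (_ : Algebra.IsAlgebraic (MvPolynomial τ K) E) (z : ι → E),
      (∀ j, z j ^ k = algebraMap (MvPolynomial τ K) E (linForm (ρ j))) ∧
        ∀ f, aeval z f = 0 ↔ f ∈ I := by
  classical
  have hk0 : k ≠ 0 := by rintro rfl; simp at hk
  let S := MvPolynomial τ K
  let F := FractionRing S
  obtain ⟨E, _, _, _, _⟩ : ∃ (E : Type (max u v)) (_ : Field E) (_ : Algebra F E),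
      IsGalois F E ∧ IsSepClosed E :=
    ⟨SeparableClosure F, inferInstance, inferInstance, inferInstance, inferInstance⟩
  let _ : Algebra S E := ((algebraMap F E).comp (algebraMap S F)).toAlgebra
  have : IsScalarTower S F E := IsScalarTower.of_algebraMap_eq fun _ => rfl
  let _ : Algebra K E := ((algebraMap S E).comp (algebraMap K S)).toAlgebra
  have : IsScalarTower K S E := IsScalarTower.of_algebraMap_eq fun _ => rfl
  have : FaithfulSMul S E := (faithfulSMul_iff_algebraMap_injective S E).mpr
    ((algebraMap F E).injective.comp (IsFractionRing.injective S F))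
  have : Algebra.IsAlgebraic S E :=
    (IsFractionRing.comap_isAlgebraic_iff (A := S) (K := F) (C := E)).mpr inferInstance
  have : NeZero (k : E) := ⟨by
    rw [← map_natCast (algebraMap K E)]
    exact (map_ne_zero _).mpr hk⟩
  -- Separably closed suffices for roots since `k ≠ 0` in `E`.
  choose z hz using fun j => IsSepClosed.exists_pow_nat_eq (algebraMap S E (linForm (ρ j))) k
  refine ⟨E, inferInstance, inferInstance, inferInstance, inferInstance, inferInstance,
    inferInstance, z, hz, fun f => ?_⟩
  have hIz : ∀ f ∈ I, aeval z f = 0 := by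
    have : I ≤ RingHom.ker (aeval z) := by
      refine hI' _ fun j => ?_
      rw [RingHom.mem_ker, map_sub, aeval_powSubst hs hz, map_pow, aeval_X, hz, sub_self]
    exact fun f hf => this hf
  refine ⟨fun hf => ?_, hIz f⟩
  refine mem_of_aeval_eq_zero hk0 hs hI hz ?_ hIz hf
  refine LinearIndependent.restrict_scalars (K := F) ?_
    (linearIndependent_root_monomials h0 hρ hk0 z hz)
  intro a b hab
  exact IsFractionRing.injective S F (by simpa [Algebra.smul_def] using hab)

end Prime

end GeneralizedFermat

namespace GeneralizedFermat

open MvPolynomial hiding zeroLocus vanishingIdeal vanishingIdeal_anti_mono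
open ProjectiveSpectrum TopologicalSpace

/-! ### Primes under an integral quotient -/

section Integral

variable {S R : Type*} [CommRing S] [CommRing R] {ψ : S →+* R} {I : Ideal R}

theorem map_mk_isPrime {P : Ideal R} [P.IsPrime] (hP : I ≤ P) :
    (P.map (Ideal.Quotient.mk I)).IsPrime :=
  Ideal.map_isPrime_of_surjective Ideal.Quotient.mk_surjective (by rwa [Ideal.mk_ker])

theorem comap_map_mk {P : Ideal R} (hP : I ≤ P) :
    (P.map (Ideal.Quotient.mk I)).comap (Ideal.Quotient.mk I) = P := by
  rw [Ideal.comap_map_of_surjective _ Ideal.Quotient.mk_surjective, sup_eq_left,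
    ← RingHom.ker_eq_comap_bot, Ideal.mk_ker]
  exact hP

/-- If `R ⧸ I` is integral over `S`, strict inclusions of primes containing `I` are strict after
contraction to `S`. -/
theorem comap_lt_comap_of_isIntegral (hψ : ((Ideal.Quotient.mk I).comp ψ).IsIntegral)
    {P Q : Ideal R} [P.IsPrime] (hIP : I ≤ P) (hPQ : P < Q) : P.comap ψ < Q.comap ψ := by
  let _ : Algebra S (R ⧸ I) := ((Ideal.Quotient.mk I).comp ψ).toAlgebra
  have := map_mk_isPrime hIP
  obtain ⟨x, hxQ, hxP⟩ := SetLike.exists_of_lt hPQ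
  have h1 := Ideal.comap_lt_comap_of_integral_mem_sdiff (R := S)
    (I := P.map (Ideal.Quotient.mk I)) (J := Q.map (Ideal.Quotient.mk I))
    (Ideal.map_mono hPQ.le) (x := Ideal.Quotient.mk I x)
    ⟨Ideal.mem_map_of_mem _ hxQ, fun h => hxP (by rw [← comap_map_mk hIP]; exact h)⟩ (hψ _)
  change Ideal.comap ((Ideal.Quotient.mk I).comp ψ) _ < Ideal.comap ((Ideal.Quotient.mk I).comp ψ) _
    at h1
  rwa [← Ideal.comap_comap, ← Ideal.comap_comap, comap_map_mk hIP,
    comap_map_mk (hIP.trans hPQ.le)] at h1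

/-- Going up for an integral quotient. -/
theorem exists_prime_ge_comap_eq (hψ : ((Ideal.Quotient.mk I).comp ψ).IsIntegral)
    {P : Ideal R} (hIP : I ≤ P) {p : Ideal S} [p.IsPrime] (hp : P.comap ψ ≤ p) :
    ∃ Q ≥ P, Q.IsPrime ∧ Q.comap ψ = p := by
  let _ : Algebra S (R ⧸ I) := ((Ideal.Quotient.mk I).comp ψ).toAlgebra
  have : Algebra.IsIntegral S (R ⧸ I) := ⟨hψ⟩
  obtain ⟨Q, hQ, hQp, hQc⟩ := Ideal.exists_ideal_over_prime_of_isIntegral (S := R ⧸ I) p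
    (P.map (Ideal.Quotient.mk I)) (by
      change Ideal.comap ((Ideal.Quotient.mk I).comp ψ) _ ≤ p
      rwa [← Ideal.comap_comap, comap_map_mk hIP])
  refine ⟨Q.comap (Ideal.Quotient.mk I), ?_, inferInstance, ?_⟩
  · exact Ideal.map_le_iff_le_comap.mp hQ
  · rw [Ideal.comap_comap]; exact hQc

end Integral

/-! ### Irreducible closed subsets of projective space -/

section Proj

variable {n : ℕ} {K : Type*} [Field K]

/-- If `fg` vanishes on `Z`, then `Z` is covered by the closed sets `f = 0` and `g = 0`, so one of
them contains it. -/
theorem isPrime_vanishingIdeal {Z : Set (ProjSpace n K)} (hZ : IsIrreducible Z) :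
    (vanishingIdeal Z).toIdeal.IsPrime := by
  refine ⟨?_, fun {f g} hfg => ?_⟩
  · obtain ⟨x, hx⟩ := hZ.nonempty
    intro h
    have h1 : (1 : MvPolynomial (Fin (n + 1)) K) ∈ (vanishingIdeal Z).toIdeal := by rw [h]; trivial
    exact x.isPrime.ne_top ((Ideal.eq_top_iff_one _).mpr ((mem_vanishingIdeal _ _).mp h1 x hx))
  · have h2 : ∀ f, f ∈ (vanishingIdeal Z).toIdeal ↔ Z ⊆ zeroLocus (grading n K) {f} := by
      intro f
      refine (mem_vanishingIdeal Z f).trans ⟨fun h x hx => ?_, fun h x hx => ?_⟩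
      · simpa using h x hx
      · simpa using h hx
    rw [h2, zeroLocus_singleton_mul] at hfg
    rw [h2, h2]
    exact isPreirreducible_iff_isClosed_union_isClosed.mp hZ.isPreirreducible _ _
      (isClosed_zeroLocus _ _) (isClosed_zeroLocus _ _) hfg

/-- A point of projective space lies strictly below the ideal of the origin. -/
theorem lt_ker_constantCoeff (x : ProjSpace n K) :
    x.asHomogeneousIdeal.toIdeal <
      RingHom.ker (constantCoeff : MvPolynomial (Fin (n + 1)) K →+* K) := by
  refine lt_of_le_not_ge (fun f hf => ?_) fun h => x.not_irrelevant_le ?_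
  · by_contra hc
    -- A homogeneous ideal contains the constant terms of its elements; a nonzero one would be a
    -- unit.
    have h1 := x.asHomogeneousIdeal.isHomogeneous 0 hf
    have h2 : ((DirectSum.decompose (grading n K) f 0 : grading n K 0) :
        MvPolynomial (Fin (n + 1)) K) = C (constantCoeff f) := by
      refine (MvPolynomial.decomposition.decompose'_apply f 0).trans ?_
      rw [homogeneousComponent_zero, constantCoeff_eq]
    rw [h2] at h1
    refine x.isPrime.ne_top (Ideal.eq_top_of_isUnit_mem _ h1 ?_)
    exact (isUnit_iff_ne_zero.mpr hc).map C
  · rw [HomogeneousIdeal.irrelevant_le]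
    intro i hi f hf
    refine h ?_
    rw [RingHom.mem_ker, constantCoeff_eq]
    by_contra hc
    have := hf hc
    simp at this
    omega

/-- A chain of irreducible closed subsets gives a chain of primes over `I`, which contracts strictly
to `S` by incomparability. The ideal of the origin lies above all of them and accounts for the extra
`1`. -/
theorem topologicalKrullDim_add_one_le {S : Type*} [CommRing S]
    {ψ : S →+* MvPolynomial (Fin (n + 1)) K} {I : Ideal (MvPolynomial (Fin (n + 1)) K)}
    (hψ : ((Ideal.Quotient.mk I).comp ψ).IsIntegral) {X : Set (ProjSpace n K)} (hX : X.Nonempty)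
    (hI : ∀ x ∈ X, I ≤ x.asHomogeneousIdeal.toIdeal) :
    topologicalKrullDim X + 1 ≤ ringKrullDim S := by
  have hne : Nonempty (IrreducibleCloseds X) := by
    obtain ⟨x, hx⟩ := hX
    exact ⟨⟨closure {⟨x, hx⟩}, isIrreducible_singleton.closure, isClosed_closure⟩⟩
  let m := RingHom.ker (constantCoeff : MvPolynomial (Fin (n + 1)) K →+* K)
  have hm : m.IsPrime := RingHom.ker_isPrime _
  let v : IrreducibleCloseds X → Ideal (MvPolynomial (Fin (n + 1)) K) := fun Z =>
    (vanishingIdeal (Subtype.val '' (Z : Set X))).toIdeal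
  have hvp : ∀ Z, (v Z).IsPrime := fun Z => isPrime_vanishingIdeal
    (Z.isIrreducible.image _ continuous_subtype_val.continuousOn)
  have hvI : ∀ Z, I ≤ v Z := fun Z f hf => (mem_vanishingIdeal _ _).mpr <| by
    rintro _ ⟨x, _, rfl⟩
    exact hI x x.2 hf
  have hvm : ∀ Z, v Z < m := fun Z => by
    obtain ⟨x, hx⟩ := Z.isIrreducible.nonempty
    refine lt_of_le_of_lt (fun f hf => ?_) (lt_ker_constantCoeff x.1)
    exact (mem_vanishingIdeal _ _).mp hf _ ⟨x, hx, rfl⟩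
  have hv : ∀ Z Z', Z < Z' → v Z' < v Z := fun Z Z' h => by
    have hZ : ∀ Z : IrreducibleCloseds X, (Z : Set X) =
        Subtype.val ⁻¹' zeroLocus (grading n K) (v Z : Set (MvPolynomial (Fin (n + 1)) K)) :=
      fun Z => by
        have h1 := zeroLocus_vanishingIdeal_eq_closure (𝒜 := grading n K)
          (Subtype.val '' (Z : Set X))
        rw [show zeroLocus (grading n K) (v Z : Set (MvPolynomial (Fin (n + 1)) K)) = _ from h1, ← Topology.IsInducing.subtypeVal.closure_eq_preimage_closure_image,
          Z.isClosed.closure_eq]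
    refine lt_of_le_of_ne (vanishingIdeal_anti_mono _ (Set.image_mono h.le)) fun he => h.ne ?_
    exact SetLike.coe_injective (by rw [hZ Z, hZ Z', he])
  -- The added bottom plays the empty set, whose prime is that of the vertex of the cone.
  let g : WithBot (IrreducibleCloseds X) → (PrimeSpectrum S)ᵒᵈ := fun Z =>
    OrderDual.toDual (Z.recBotCoe ⟨m.comap ψ, Ideal.IsPrime.comap ψ⟩
      fun Z => ⟨(v Z).comap ψ, (hvp Z).comap ψ⟩)
  have hg : StrictMono g := by
    intro Z Z' h
    change (g Z').ofDual < (g Z).ofDual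
    rw [← PrimeSpectrum.asIdeal_lt_asIdeal]
    induction Z' with
    | bot => exact absurd h not_lt_bot
    | coe Z' =>
      have := hvp Z'
      induction Z with
      | bot => exact comap_lt_comap_of_isIntegral hψ (hvI Z') (hvm Z')
      | coe Z => exact comap_lt_comap_of_isIntegral hψ (hvI Z') (hv _ _ (WithBot.coe_lt_coe.mp h))
  have := Order.krullDim_le_of_strictMono g hg
  rwa [Order.krullDim_withBot, Order.krullDim_orderDual] at this

/-- Larger primes have smaller closures, so chains of points give chains of irreducible closed sets.
-/
theorem krullDim_le_topologicalKrullDim (X : Set (ProjSpace n K)) :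
    Order.krullDim X ≤ topologicalKrullDim X := by
  let g : X → (IrreducibleCloseds X)ᵒᵈ := fun x =>
    OrderDual.toDual ⟨closure {x}, isIrreducible_singleton.closure, isClosed_closure⟩
  have hmem : ∀ x y : X, x ≤ y ↔ y ∈ closure ({x} : Set X) := fun x y => by
    refine Iff.trans ?_ closure_subtype.symm
    rw [Set.image_singleton, ← le_iff_mem_closure]
    rfl
  have hg : StrictMono g := by
    intro x y h
    change (g y).ofDual < (g x).ofDual
    refine lt_of_le_not_ge ?_ fun hh => h.not_ge ?_
    · exact closure_minimal (Set.singleton_subset_iff.mpr ((hmem x y).mp h.le)) isClosed_closure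
    · exact (hmem y x).mpr (hh (subset_closure rfl))
  have := Order.krullDim_le_of_strictMono g hg
  rwa [Order.krullDim_orderDual] at this

/-- The prime ideal `(t_0, …, t_{r-1})`. -/
noncomputable def flagIdeal (K : Type*) [Field K] (d r : ℕ) :
    Ideal (MvPolynomial (Fin (d + 1)) K) :=
  RingHom.ker (aeval (R := K) fun i : Fin (d + 1) =>
    if (i : ℕ) < r then (0 : MvPolynomial (Fin (d + 1)) K) else X i)

instance (d r : ℕ) : (flagIdeal K d r).IsPrime := RingHom.ker_isPrime _

theorem X_mem_flagIdeal {d r : ℕ} (i : Fin (d + 1)) : X i ∈ flagIdeal K d r ↔ (i : ℕ) < r := by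
  rw [flagIdeal, RingHom.mem_ker, aeval_X]
  split_ifs with h <;> simp [h]

/-- Killing the first `r` variables changes nothing modulo `J`. -/
theorem flagIdeal_le {d r : ℕ} {J : Ideal (MvPolynomial (Fin (d + 1)) K)}
    (hJ : ∀ i : Fin (d + 1), (i : ℕ) < r → X i ∈ J) : flagIdeal K d r ≤ J := by
  intro f hf
  have h1 : (Ideal.Quotient.mkₐ K J).comp (aeval (R := K) fun i : Fin (d + 1) =>
      if (i : ℕ) < r then (0 : MvPolynomial (Fin (d + 1)) K) else X i) =
      Ideal.Quotient.mkₐ K J := by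
    refine MvPolynomial.algHom_ext fun i => ?_
    rw [AlgHom.comp_apply, aeval_X]
    split_ifs with h
    · rw [map_zero, eq_comm]
      exact Ideal.Quotient.eq_zero_iff_mem.mpr (hJ i h)
    · rfl
  have h2 := DFunLike.congr_fun h1 f
  rw [AlgHom.comp_apply, (RingHom.mem_ker).mp hf, map_zero] at h2
  exact Ideal.Quotient.eq_zero_iff_mem.mp h2.symm

/-- Going up lifts the flag `0 ⊂ (t_0) ⊂ ⋯ ⊂ (t_0, …, t_{d-1})` to a chain of points of `X` starting
at the generic one. Each lifted prime is replaced by its homogeneous core to stay in projective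
space. -/
theorem le_krullDim_of_isIntegral {d k : ℕ} (hk : 0 < k) {s : Fin (d + 1) → Fin (n + 1)}
    {I : Ideal (MvPolynomial (Fin (n + 1)) K)}
    (hψ : ((Ideal.Quotient.mk I).comp (powSubst K k s).toRingHom).IsIntegral)
    (hI0 : I.comap (powSubst K k s).toRingHom = ⊥)
    (x₀ : ProjSpace n K) (hx₀ : x₀.asHomogeneousIdeal.toIdeal = I) {X : Set (ProjSpace n K)}
    (hX : ∀ x, x ∈ X ↔ I ≤ x.asHomogeneousIdeal.toIdeal) :
    (d : WithBot ℕ∞) ≤ Order.krullDim X := by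
  let ψ := (powSubst K k s).toRingHom
  have key : ∀ r ≤ d, ∃ l : LTSeries X, l.length = r ∧
      l.last.1.asHomogeneousIdeal.toIdeal.comap ψ = flagIdeal K d r := by
    intro r
    induction r with
    | zero =>
      intro _
      refine ⟨RelSeries.singleton _ ⟨x₀, (hX x₀).mpr hx₀.ge⟩, rfl, ?_⟩
      rw [RelSeries.last_singleton, hx₀, hI0]
      exact (eq_bot_iff.mpr (flagIdeal_le (by simp))).symm
    | succ r ih =>
      intro hr
      obtain ⟨l, hl, hlast⟩ := ih (by omega)
      have hIl := (hX _).mp l.last.2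
      obtain ⟨Q, hQ, hQp, hQc⟩ := exists_prime_ge_comap_eq (P := l.last.1.asHomogeneousIdeal.toIdeal)
        (p := flagIdeal K d (r + 1)) hψ hIl (by
          rw [hlast]
          exact flagIdeal_le fun i hi => (X_mem_flagIdeal i).mpr (by omega))
      have hle : l.last.1.asHomogeneousIdeal ≤ Q.homogeneousCore (grading n K) :=
        (Ideal.homogeneousCore.gc (grading n K) _ _).mp hQ
      have hψX : ∀ i, ψ (MvPolynomial.X i) = MvPolynomial.X (s i) ^ k := fun i => by
        change powSubst K k s (MvPolynomial.X i) = _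
        simp [powSubst]
      -- The core has the same contraction, because the generators `t_i` map to the homogeneous
      -- elements `x_{s(i)}^k`.
      have hcore : (Q.homogeneousCore (grading n K)).toIdeal.comap ψ = flagIdeal K d (r + 1) := by
        refine le_antisymm ?_ (flagIdeal_le fun i hi => ?_)
        · rw [← hQc]
          exact Ideal.comap_mono (Ideal.toIdeal_homogeneousCore_le _ _)
        · have h1 := (X_mem_flagIdeal (K := K) i).mpr hi
          rw [← hQc] at h1
          rw [Ideal.mem_comap] at h1 ⊢
          refine Ideal.mem_homogeneousCore_of_homogeneous_of_mem ?_ h1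
          rw [hψX]
          exact ⟨_, (isHomogeneous_X_pow _ _)⟩
      -- The flag stops before the last variable `t_d`, which keeps the core from containing the
      -- irrelevant ideal.
      let y : ProjSpace n K := ⟨Q.homogeneousCore (grading n K), hQp.homogeneousCore, fun h => by
        have h1 : MvPolynomial.X (s (Fin.last d)) ∈ Q.homogeneousCore (grading n K) :=
          h (HomogeneousIdeal.mem_irrelevant_of_mem (grading n K) one_pos (isHomogeneous_X K _))
        have h2 : MvPolynomial.X (Fin.last d) ∈ flagIdeal K d (r + 1) := by
          rw [← hQc, Ideal.mem_comap, hψX]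
          exact Ideal.pow_mem_of_mem _ (Ideal.toIdeal_homogeneousCore_le _ _ h1) _ hk
        rw [X_mem_flagIdeal, Fin.val_last] at h2
        omega⟩
      have hyX : y ∈ X := (hX y).mpr (hIl.trans hle)
      have hlt : l.last < ⟨y, hyX⟩ := by
        refine lt_of_le_of_ne hle fun he => ?_
        rw [he] at hlast
        have := hcore.symm.trans hlast
        have h2 := (X_mem_flagIdeal (K := K) (r := r + 1) (⟨r, by omega⟩ : Fin (d + 1))).mpr
          (Nat.lt_succ_self r)
        rw [this, X_mem_flagIdeal] at h2
        simp at h2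
      exact ⟨l.snoc ⟨y, hyX⟩ hlt, by simp [hl], by rw [RelSeries.last_snoc]; exact hcore⟩
  obtain ⟨l, hl, -⟩ := key d le_rfl
  rw [← hl]
  exact Order.LTSeries.length_le_krullDim l

end Proj

end GeneralizedFermat

namespace GeneralizedFermat

/-! ### Unramified integral extensions of regular rings -/

section Unramified

open IsLocalRing

/-- An unramified localization of an integral extension domain of a regular integrally closed domain
is regular. -/
theorem isRegularLocalRing_of_formallyUnramified {T D O : Type*} [CommRing T] [IsDomain T]
    [IsIntegrallyClosed T] [IsRegularRing T] [CommRing D] [IsDomain D] [Algebra T D]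
    [FaithfulSMul T D] [Algebra.IsIntegral T D] [Algebra.FiniteType T D] (Q : Ideal D) [Q.IsPrime]
    [CommRing O] [Algebra D O] [IsLocalization.AtPrime O Q] [Algebra T O] [IsScalarTower T D O]
    [Algebra.FormallyUnramified T O] : IsRegularLocalRing O := by
  let q := Q.under T
  let DQ := Localization.AtPrime Q
  let Tq := Localization.AtPrime q
  let e : DQ ≃ₐ[D] O := IsLocalization.algEquiv Q.primeCompl DQ O
  have : Algebra.IsUnramifiedAt T Q :=
    Algebra.FormallyUnramified.of_equiv (e.restrictScalars T).symm
  let _ : Algebra Tq DQ := Localization.AtPrime.algebraOfLiesOver q Q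
  have hmap := ((Algebra.isUnramifiedAt_iff_map_eq T q Q).mp inferInstance).2
  have hmap' : (maximalIdeal Tq).map (algebraMap Tq DQ) = maximalIdeal DQ := by
    rw [← hmap, ← Localization.AtPrime.map_eq_maximalIdeal, Ideal.map_map,
      ← IsScalarTower.algebraMap_eq]
  have hN : IsNoetherianRing D := Algebra.FiniteType.isNoetherianRing T D
  have : IsNoetherianRing DQ := IsLocalization.isNoetherianRing Q.primeCompl DQ hN
  have hreg : IsRegularLocalRing Tq := IsRegularRing.isRegularLocalRing_localization q
  have : IsRegularLocalRing DQ := by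
    refine IsRegularLocalRing.of_spanFinrank_maximalIdeal_le _ ?_
    -- Unramified: generators of the maximal ideal below also generate the one above.
    have h1 : (maximalIdeal DQ).spanFinrank ≤ (maximalIdeal Tq).spanFinrank := by
      rw [← hmap']
      exact Ideal.spanFinrank_map_le_of_fg _ (IsNoetherian.noetherian _)
    refine le_trans (b := ((maximalIdeal Tq).spanFinrank : WithBot ℕ∞)) (by exact_mod_cast h1) ?_
    rw [hreg.spanFinrank_maximalIdeal, IsLocalization.AtPrime.ringKrullDim_eq_height q Tq,
      IsLocalization.AtPrime.ringKrullDim_eq_height Q DQ]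
    -- Going down holds since `T` is integrally closed, so the height does not drop from `q` to `Q`.
    rw [Ideal.height_eq_height_add_of_liesOver_of_hasGoingDown q Q]
    exact_mod_cast le_self_add
  exact IsRegularLocalRing.of_ringEquiv e.toRingEquiv

end Unramified

end GeneralizedFermat

namespace GeneralizedFermat

/-! ### Regularity of local domains generated by roots -/

section Radical

open IsLocalRing

variable {T O : Type*} [CommRing T] [CommRing O] [Algebra T O]

/-- If every element of a local domain `O` is a fraction of elements of a subring `D`, then `O` is
the localization of `D` at the contraction of the maximal ideal. -/
theorem isLocalization_atPrime_comap [IsLocalRing O] (D : Subalgebra T O)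
    (hfrac : ∀ o : O, ∃ a ∈ D, ∃ b ∈ D, IsUnit b ∧ o * b = a) :
    IsLocalization.AtPrime O ((maximalIdeal O).comap (algebraMap D O)) where
  map_units y := by
    have := y.2
    rw [Ideal.mem_primeCompl_iff, Ideal.mem_comap, mem_maximalIdeal, mem_nonunits_iff,
      not_not] at this
    exact this
  surj o := by
    obtain ⟨a, ha, b, hb, hu, h⟩ := hfrac o
    refine ⟨⟨⟨a, ha⟩, ⟨⟨b, hb⟩, ?_⟩⟩, h⟩
    rw [Ideal.mem_primeCompl_iff, Ideal.mem_comap, mem_maximalIdeal, mem_nonunits_iff, not_not]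
    exact hu
  exists_of_eq {x y} h := ⟨1, by rw [Subtype.ext h]⟩

/-- A derivation over `T` kills `k`-th roots of elements of `T`, hence an algebra generated by
`k`-th roots which are units is formally unramified. -/
theorem formallyUnramified_of_roots {ι : Type*} {k : ℕ} (hk : IsUnit (k : T)) (v : ι → O)
    (hv : ∀ i, v i ∈ Set.range (algebraMap T O) ∨
      IsUnit (v i) ∧ v i ^ k ∈ Set.range (algebraMap T O))
    (hfrac : ∀ o : O, ∃ a ∈ Algebra.adjoin T (Set.range v), ∃ b ∈ Algebra.adjoin T (Set.range v),
      IsUnit b ∧ o * b = a) : Algebra.FormallyUnramified T O := by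
  let δ := KaehlerDifferential.D T O
  have h1 : ∀ i, δ (v i) = 0 := by
    intro i
    rcases hv i with ⟨t, ht⟩ | ⟨hu, t, ht⟩
    · rw [← ht, Derivation.map_algebraMap]
    · have h2 : δ (v i ^ k) = 0 := by rw [← ht, Derivation.map_algebraMap]
      -- Here `k v^{k-1} dv = 0` with a unit coefficient.
      rw [Derivation.leibniz_pow, ← Nat.cast_smul_eq_nsmul O, smul_smul] at h2
      have hk' : IsUnit (k : O) := by simpa using hk.map (algebraMap T O)
      exact (hk'.mul (hu.pow _)).smul_eq_zero.mp h2
  have h2 : ∀ a ∈ Algebra.adjoin T (Set.range v), δ a = 0 := by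
    intro a ha
    induction ha using Algebra.adjoin_induction with
    | mem x hx => obtain ⟨i, rfl⟩ := hx; exact h1 i
    | algebraMap r => exact δ.map_algebraMap r
    | add x y _ _ hx hy => rw [map_add, hx, hy, add_zero]
    | mul x y _ _ hx hy => rw [Derivation.leibniz, hx, hy, smul_zero, smul_zero, add_zero]
  have h3 : ∀ o, δ o = 0 := by
    intro o
    obtain ⟨a, ha, b, hb, hu, h⟩ := hfrac o
    have h4 := h2 a ha
    rw [← h, Derivation.leibniz, h2 b hb, smul_zero, zero_add] at h4
    exact hu.smul_eq_zero.mp h4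
  refine ⟨?_⟩
  rw [← Submodule.subsingleton_iff O, ← subsingleton_iff_bot_eq_top,
    ← KaehlerDifferential.span_range_derivation, eq_comm, Submodule.span_eq_bot]
  rintro _ ⟨o, rfl⟩
  exact h3 o

theorem isRegularLocalRing_of_roots [IsDomain T] [IsIntegrallyClosed T] [IsRegularRing T]
    [IsDomain O] [IsLocalRing O] (hTO : Function.Injective (algebraMap T O))
    {ι : Type*} [Finite ι] {k : ℕ} (hk : IsUnit (k : T)) (hk0 : 0 < k) (v : ι → O)
    (hv : ∀ i, v i ∈ Set.range (algebraMap T O) ∨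
      IsUnit (v i) ∧ v i ^ k ∈ Set.range (algebraMap T O))
    (hfrac : ∀ o : O, ∃ a ∈ Algebra.adjoin T (Set.range v), ∃ b ∈ Algebra.adjoin T (Set.range v),
      IsUnit b ∧ o * b = a) : IsRegularLocalRing O := by
  let D := Algebra.adjoin T (Set.range v)
  have : Algebra.IsIntegral T D := by
    refine Algebra.IsIntegral.adjoin ?_
    rintro _ ⟨i, rfl⟩
    rcases hv i with ⟨t, ht⟩ | ⟨-, t, ht⟩
    · rw [← ht]; exact isIntegral_algebraMap
    · exact IsIntegral.of_pow hk0 (by rw [← ht]; exact isIntegral_algebraMap)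
  have : Algebra.FiniteType T D :=
    (Subalgebra.fg_iff_finiteType _).mp (Subalgebra.fg_def.mpr ⟨_, Set.finite_range v, rfl⟩)
  have : FaithfulSMul T D := (faithfulSMul_iff_algebraMap_injective T D).mpr fun a b h =>
    hTO (congrArg (algebraMap D O) h)
  have := isLocalization_atPrime_comap D hfrac
  have := formallyUnramified_of_roots hk v hv hfrac
  exact isRegularLocalRing_of_formallyUnramified (T := T)
    ((maximalIdeal O).comap (algebraMap D O))

end Radical

end GeneralizedFermat

namespace GeneralizedFermat

open MvPolynomial hiding zeroLocus vanishingIdeal vanishingIdeal_anti_mono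

theorem aeval_mul_of_isHomogeneous {K σ A : Type*} [CommRing K] [CommRing A] [Algebra K A]
    {f : MvPolynomial σ K} {m : ℕ} (hf : f.IsHomogeneous m) (u : A) (w : σ → A) :
    aeval (fun i => u * w i) f = u ^ m * aeval w f := by
  rw [aeval_def, aeval_def, eval₂_eq, eval₂_eq, Finset.mul_sum]
  refine Finset.sum_congr rfl fun d hd => ?_
  have h1 : ∑ i ∈ d.support, d i = m := by
    have := hf (mem_support_iff.mp hd)
    simpa [Finsupp.weight_apply, Finsupp.sum] using this
  simp only [mul_pow, Finset.prod_mul_distrib, Finset.prod_pow_eq_pow_sum, h1]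
  ring

/-! ### Local rings of projective varieties -/

section LocalRing

variable {n : ℕ} {K : Type*} [Field K] (x : ProjSpace n K)

/-- The local ring of projective space at `x`. -/
abbrev ambientLocalRing : Type _ :=
  HomogeneousLocalization.AtPrime (grading n K) x.asHomogeneousIdeal.toIdeal

/-- The local ring of the affine cone at the prime ideal of `x`. -/
abbrev ringAt : Type _ := Localization.AtPrime x.asHomogeneousIdeal.toIdeal

variable {j₀ : Fin (n + 1)} (h : X j₀ ∉ x.asHomogeneousIdeal.toIdeal)

/-- The rational function `x_i / x_{j₀}`. -/
noncomputable def coordRatio (i : Fin (n + 1)) : ambientLocalRing x :=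
  HomogeneousLocalization.mk
    ⟨1, ⟨X i, isHomogeneous_X K i⟩, ⟨X j₀, isHomogeneous_X K j₀⟩, h⟩

/-- Dehomogenization with respect to `x_{j₀}`. -/
noncomputable def dehomogenize : MvPolynomial (Fin (n + 1)) K →+* ambientLocalRing x :=
  eval₂Hom ((HomogeneousLocalization.fromZeroRingHom (grading n K) _).comp
    (algebraMap K (grading n K 0))) (coordRatio x h)

theorem dehomogenize_X (i : Fin (n + 1)) : dehomogenize x h (X i) = coordRatio x h i := by
  simp [dehomogenize]

theorem dehomogenize_X_self : dehomogenize x h (X j₀) = 1 := by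
  rw [dehomogenize_X]
  apply HomogeneousLocalization.val_injective
  rw [coordRatio, HomogeneousLocalization.val_mk, HomogeneousLocalization.val_one]
  exact Localization.mk_self (⟨X j₀, h⟩ : x.asHomogeneousIdeal.toIdeal.primeCompl)

theorem val_dehomogenize (f : MvPolynomial (Fin (n + 1)) K) :
    (dehomogenize x h f).val = aeval (fun i => (coordRatio x h i).val) f := by
  induction f using MvPolynomial.induction_on with
  | C a =>
    rw [dehomogenize, coe_eval₂Hom, eval₂_C, aeval_C]
    rw [IsScalarTower.algebraMap_apply K (MvPolynomial (Fin (n + 1)) K)]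
    exact Localization.mk_one_eq_algebraMap _
  | add p q hp hq => rw [map_add, HomogeneousLocalization.val_add, hp, hq, map_add]
  | mul_X p i hp =>
    rw [map_mul, HomogeneousLocalization.val_mul, hp, map_mul, aeval_X, dehomogenize_X]

/-- This is `f = x_{j₀}^m f(x / x_{j₀})`. Since `x_{j₀}` is a unit at `x`, it moves statements
between the cone and the projective local ring. -/
theorem val_dehomogenize_mul_pow {f : MvPolynomial (Fin (n + 1)) K} {m : ℕ}
    (hf : f.IsHomogeneous m) :
    algebraMap (MvPolynomial (Fin (n + 1)) K) (ringAt x) (X j₀) ^ m *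
      (dehomogenize x h f).val = algebraMap _ (ringAt x) f := by
  rw [val_dehomogenize, ← aeval_mul_of_isHomogeneous hf]
  have h1 : (aeval fun i => algebraMap (MvPolynomial (Fin (n + 1)) K) (ringAt x)
      (X j₀) * (coordRatio x h i).val) = IsScalarTower.toAlgHom K (MvPolynomial (Fin (n + 1)) K)
      (ringAt x) := by
    refine MvPolynomial.algHom_ext fun i => ?_
    rw [aeval_X, coordRatio, HomogeneousLocalization.val_mk, Localization.mk_eq_mk', mul_comm]
    exact IsLocalization.mk'_spec _ _ _
  exact DFunLike.congr_fun h1 f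

theorem isUnit_algebraMap_coord (h : X j₀ ∉ x.asHomogeneousIdeal.toIdeal) :
    IsUnit (algebraMap (MvPolynomial (Fin (n + 1)) K) (ringAt x) (X j₀)) :=
  IsLocalization.map_units _ (⟨X j₀, h⟩ : x.asHomogeneousIdeal.toIdeal.primeCompl)

theorem isUnit_dehomogenize {f : MvPolynomial (Fin (n + 1)) K} {m : ℕ} (hf : f.IsHomogeneous m)
    (hfx : f ∉ x.asHomogeneousIdeal.toIdeal) : IsUnit (dehomogenize x h f) := by
  rw [← HomogeneousLocalization.isUnit_iff_isUnit_val]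
  have h1 := IsLocalization.map_units (ringAt x)
    (⟨f, hfx⟩ : x.asHomogeneousIdeal.toIdeal.primeCompl)
  rw [← val_dehomogenize_mul_pow x h hf] at h1
  exact isUnit_of_mul_isUnit_right h1

theorem exists_dehomogenize_fraction (a : ambientLocalRing x) :
    ∃ f g : MvPolynomial (Fin (n + 1)) K, IsUnit (dehomogenize x h g) ∧
      a * dehomogenize x h g = dehomogenize x h f := by
  obtain ⟨⟨m, f, g, hg⟩, rfl⟩ := HomogeneousLocalization.mk_surjective a
  refine ⟨f, g, isUnit_dehomogenize x h g.2 hg, ?_⟩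
  apply HomogeneousLocalization.val_injective
  refine ((isUnit_algebraMap_coord x h).pow m).mul_left_cancel ?_
  rw [HomogeneousLocalization.val_mul, mul_left_comm, val_dehomogenize_mul_pow x h g.2,
    val_dehomogenize_mul_pow x h f.2, HomogeneousLocalization.val_mk, Localization.mk_eq_mk']
  exact IsLocalization.mk'_spec _ _ _

/-- The ideal of the germs at `x` of functions vanishing on the variety with ideal `I`. -/
noncomputable abbrev germIdeal (I : Ideal (MvPolynomial (Fin (n + 1)) K)) :
    Ideal (ambientLocalRing x) :=
  (I.map (algebraMap (MvPolynomial (Fin (n + 1)) K) (ringAt x))).comap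
    (algebraMap (ambientLocalRing x) (ringAt x))

theorem dehomogenize_mem_germIdeal {I : Ideal (MvPolynomial (Fin (n + 1)) K)}
    {f : MvPolynomial (Fin (n + 1)) K} {m : ℕ} (hf : f.IsHomogeneous m) (hfI : f ∈ I) :
    dehomogenize x h f ∈ germIdeal x I := by
  rw [Ideal.mem_comap, HomogeneousLocalization.algebraMap_apply,
    ← Ideal.unit_mul_mem_iff_mem _ ((isUnit_algebraMap_coord x h).pow m),
    val_dehomogenize_mul_pow x h hf]
  exact Ideal.mem_map_of_mem _ hfI

theorem germIdeal_isPrime {I : Ideal (MvPolynomial (Fin (n + 1)) K)} [hI : I.IsPrime]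
    (hIx : I ≤ x.asHomogeneousIdeal.toIdeal) : (germIdeal x I).IsPrime := by
  have : (I.map (algebraMap (MvPolynomial (Fin (n + 1)) K) (ringAt x))).IsPrime :=
    IsLocalization.isPrime_of_isPrime_disjoint x.asHomogeneousIdeal.toIdeal.primeCompl _ I hI
      (Set.disjoint_left.mpr fun f hf hf' => hf (hIx hf'))
  exact Ideal.IsPrime.comap _

/-- A point with ideal `I` in a field extension defines a homomorphism from the local ring. -/
theorem exists_germ_eval {I : Ideal (MvPolynomial (Fin (n + 1)) K)}
    (hIx : I ≤ x.asHomogeneousIdeal.toIdeal) {E : Type*} [Field E] [Algebra K E]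
    {z : Fin (n + 1) → E} (hz : ∀ f, aeval z f = 0 ↔ f ∈ I) :
    ∃ θ : ambientLocalRing x ⧸ germIdeal x I →+* E, ∀ f,
      θ (Ideal.Quotient.mk _ (dehomogenize x h f)) = aeval (fun i => z i / z j₀) f := by
  -- A polynomial outside the prime of `x` is outside `I`, so it does not vanish at the generic
  -- point.
  have hu : ∀ y : x.asHomogeneousIdeal.toIdeal.primeCompl, IsUnit ((aeval z).toRingHom y.1) :=
    fun y => isUnit_iff_ne_zero.mpr fun h0 => y.2 (hIx ((hz _).mp h0))
  let ev : ringAt x →+* E := IsLocalization.lift hu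
  have hev : ∀ f, ev (algebraMap _ _ f) = aeval z f := fun f => IsLocalization.lift_eq hu f
  have hevI : I.map (algebraMap (MvPolynomial (Fin (n + 1)) K) (ringAt x)) ≤
      RingHom.ker ev := by
    rw [Ideal.map_le_iff_le_comap]
    intro f hf
    rw [Ideal.mem_comap, RingHom.mem_ker, hev, (hz f).mpr hf]
  refine ⟨Ideal.Quotient.lift _ (ev.comp (algebraMap (ambientLocalRing x) _))
    fun a ha => hevI (Ideal.mem_comap.mp ha), fun f => ?_⟩
  have hz0 : z j₀ ≠ 0 := fun h0 => h (hIx ((hz _).mp (by rw [aeval_X, h0])))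
  refine (Ideal.Quotient.lift_mk _ _ _).trans ?_
  rw [RingHom.comp_apply, HomogeneousLocalization.algebraMap_apply]
  have hX : ∀ i, ev (coordRatio x h i).val = z i / z j₀ := by
    intro i
    rw [eq_div_iff hz0, mul_comm]
    have h1 := congrArg ev (val_dehomogenize_mul_pow x h (isHomogeneous_X K i))
    rwa [map_mul, pow_one, hev, hev, aeval_X, aeval_X, dehomogenize_X] at h1
  rw [val_dehomogenize]
  induction f using MvPolynomial.induction_on with
  | C a =>
    rw [aeval_C, aeval_C, IsScalarTower.algebraMap_apply K (MvPolynomial (Fin (n + 1)) K), hev,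
      algebraMap_eq, aeval_C]
  | add p q hp hq => rw [map_add, map_add, map_add, hp, hq]
  | mul_X p i hp => rw [map_mul, map_mul, map_mul, hp, aeval_X, aeval_X, hX]

end LocalRing

end GeneralizedFermat

namespace GeneralizedFermat

open MvPolynomial hiding zeroLocus vanishingIdeal vanishingIdeal_anti_mono

/-! ### Nonsingularity of generalized Fermat varieties -/

section Coordinates

variable {K : Type*} [Field K] {d : ℕ} {ι : Type*}

theorem exists_eq_sum_smul {ρ : ι → Fin (d + 1) → K} {J : Finset ι} (hJ : J.card = d + 1)
    (hli : LinearIndependent K fun j : J => ρ j) (v : Fin (d + 1) → K) :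
    ∃ c : J → K, v = ∑ j, c j • ρ j := by
  have hspan := hli.span_eq_top_of_card_eq_finrank' (by simp [hJ])
  have hv : v ∈ Submodule.span K (Set.range fun j : J => ρ j) := by rw [hspan]; trivial
  obtain ⟨c, hc⟩ := (Submodule.mem_span_range_iff_exists_fun K).mp hv
  exact ⟨c, hc.symm⟩

theorem linForm_sum {α τ : Type*} [Fintype τ] (s : Finset α) (c : α → K) (v : α → τ → K) :
    linForm (∑ j ∈ s, c j • v j) = ∑ j ∈ s, C (c j) * linForm (v j) := by
  classical
  induction s using Finset.induction_on with
  | empty => simp [linForm_zero]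
  | insert a s ha ih => rw [Finset.sum_insert ha, Finset.sum_insert ha, linForm_add, linForm_smul, ih]

variable {E : Type*} [Field E] [Algebra K E] [Algebra (MvPolynomial (Fin (d + 1)) K) E]
  [IsScalarTower K (MvPolynomial (Fin (d + 1)) K) E]

/-- Any `d + 1` coordinates with independent forms can replace the first `d + 1`, since their forms
span all linear forms. -/
theorem root_relation {ρ : ι → Fin (d + 1) → K} {k : ℕ} {z : ι → E}
    (hz : ∀ j, z j ^ k = algebraMap (MvPolynomial (Fin (d + 1)) K) E (linForm (ρ j)))
    {J : Finset ι} (hJ : J.card = d + 1) (hli : LinearIndependent K fun j : J => ρ j) (i : ι) :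
    ∃ c : J → K, aeval z (X i ^ k - ∑ j, C (c j) * X j.1 ^ k : MvPolynomial ι K) = 0 := by
  obtain ⟨c, hc⟩ := exists_eq_sum_smul hJ hli (ρ i)
  refine ⟨c, ?_⟩
  rw [map_sub, map_pow, aeval_X, hz, hc, linForm_sum, map_sum, map_sum, sub_eq_zero]
  refine Finset.sum_congr rfl fun j _ => ?_
  rw [map_mul, map_mul, map_pow, aeval_X, aeval_C, hz,
    IsScalarTower.algebraMap_apply K (MvPolynomial (Fin (d + 1)) K) E, algebraMap_eq]

/-- The ratios of the coordinates of the generic point with indices in a basis are algebraically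
independent. -/
theorem algebraicIndependent_ratio [FaithfulSMul (MvPolynomial (Fin (d + 1)) K) E]
    [Algebra.IsAlgebraic (MvPolynomial (Fin (d + 1)) K) E]
    {ρ : ι → Fin (d + 1) → K} {k : ℕ} {z : ι → E}
    (hz : ∀ j, z j ^ k = algebraMap (MvPolynomial (Fin (d + 1)) K) E (linForm (ρ j)))
    {J : Finset ι} (hJ : J.card = d + 1) (hli : LinearIndependent K fun j : J => ρ j)
    {j₀ : ι} (hj₀ : j₀ ∈ J) (hz0 : z j₀ ≠ 0) :
    AlgebraicIndependent K fun j : {j // j ∈ J ∧ j ≠ j₀} => z j / z j₀ := by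
  classical
  let S := MvPolynomial (Fin (d + 1)) K
  -- Keeping `z j₀` beside the ratios gives `d + 1` elements over which `E` is algebraic. The
  -- transcendence degree is `d + 1`, so they form a transcendence basis.
  let y : J → E := fun j => if j.1 = j₀ then z j₀ else z j / z j₀
  let A := Algebra.adjoin K (Set.range y)
  let M := Subalgebra.algebraicClosure A E
  have hA : ∀ a ∈ A, a ∈ M := fun a ha => isAlgebraic_algebraMap (⟨a, ha⟩ : A)
  have hy : ∀ j, y j ∈ M := fun j => hA _ (Algebra.subset_adjoin ⟨j, rfl⟩)
  have hz0M : z j₀ ∈ M := by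
    have := hy ⟨j₀, hj₀⟩
    simpa [y] using this
  have hzM : ∀ j : J, z j ∈ M := by
    intro j
    by_cases h : j.1 = j₀
    · rw [h]; exact hz0M
    · have := M.mul_mem (hy j) hz0M
      simpa [y, h, hz0] using this
  have hKM : ∀ a : K, algebraMap K E a ∈ M := fun a => hA _ (A.algebraMap_mem a)
  have hlin : ∀ v, algebraMap S E (linForm v) ∈ M := by
    intro v
    obtain ⟨c, hc⟩ := exists_eq_sum_smul hJ hli v
    rw [hc, linForm_sum, map_sum]
    refine M.sum_mem fun j _ => ?_
    rw [map_mul, ← hz, ← algebraMap_eq, ← IsScalarTower.algebraMap_apply]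
    exact M.mul_mem (hKM _) (M.pow_mem (hzM j) _)
  have hS : ∀ f, algebraMap S E f ∈ M := by
    intro f
    induction f using MvPolynomial.induction_on with
    | C a => rw [← algebraMap_eq, ← IsScalarTower.algebraMap_apply]; exact hKM a
    | add p q hp hq => rw [map_add]; exact M.add_mem hp hq
    | mul_X p i hp =>
      rw [map_mul]
      refine M.mul_mem hp ?_
      rw [← linForm_single]
      exact hlin _
  let _ : Algebra S M := ((algebraMap S E).codRestrict M.toSubsemiring hS).toAlgebra
  have : IsScalarTower S M E := IsScalarTower.of_algebraMap_eq fun _ => rfl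
  have : Algebra.IsAlgebraic M E := by
    refine Algebra.IsAlgebraic.extendScalars (R := S) fun a b hab => ?_
    exact FaithfulSMul.algebraMap_injective S E (congrArg (algebraMap M E) hab)
  have : Algebra.IsAlgebraic A E := Algebra.IsAlgebraic.trans A M E
  have htb : IsTranscendenceBasis K (algebraMap S E ∘ X) :=
    (IsTranscendenceBasis.mvPolynomial (Fin (d + 1)) K).algebraMap_comp
  have hcard := htb.lift_cardinalMk_eq_trdeg
  have hyb : IsTranscendenceBasis K y := by
    refine Algebra.IsAlgebraic.isTranscendenceBasis_of_lift_le_trdeg_of_finite K y ?_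
    simp only [Cardinal.mk_fintype, Fintype.card_coe, hJ, Fintype.card_fin,
      Cardinal.lift_natCast] at hcard ⊢
    have ht : Algebra.trdeg K E = (d + 1 : ℕ) := by rw [hcard, Cardinal.lift_uzero]
    rw [ht, Cardinal.lift_natCast]
  have := hyb.1.comp (fun j : {j // j ∈ J ∧ j ≠ j₀} => (⟨j.1, j.2.1⟩ : J))
    fun a b hab => Subtype.ext (congrArg (fun j : J => j.1) hab)
  convert this using 2 with j
  simp [y, j.2.2]

end Coordinates

section Nonsingular

variable {K : Type*} [Field K] {d n : ℕ} {E : Type*} [Field E] [Algebra K E]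
  [Algebra (MvPolynomial (Fin (d + 1)) K) E] [IsScalarTower K (MvPolynomial (Fin (d + 1)) K) E]

/-- At a point of the variety at most `d` coordinates vanish, so the vanishing coordinates are part
of a coordinate system with a nonvanishing coordinate. -/
theorem exists_coordinates (hdn : d ≤ n) {ρ : Fin (n + 1) → Fin (d + 1) → K}
    (hρ : ∀ J : Finset (Fin (n + 1)), J.card = d + 1 → LinearIndependent K fun j : J => ρ j)
    {k : ℕ} {z : Fin (n + 1) → E}
    (hz : ∀ j, z j ^ k = algebraMap (MvPolynomial (Fin (d + 1)) K) E (linForm (ρ j)))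
    (hk : 0 < k) {x : ProjSpace n K}
    (hx : ∀ f, aeval z f = 0 → f ∈ x.asHomogeneousIdeal.toIdeal) :
    ∃ J : Finset (Fin (n + 1)), J.card = d + 1 ∧ (∀ j, X j ∈ x.asHomogeneousIdeal.toIdeal → j ∈ J) ∧
      ∃ j₀ ∈ J, X j₀ ∉ x.asHomogeneousIdeal.toIdeal := by
  classical
  let V : Finset (Fin (n + 1)) := {j | X j ∈ x.asHomogeneousIdeal.toIdeal}
  have hV : ∀ j, j ∈ V ↔ X j ∈ x.asHomogeneousIdeal.toIdeal := fun j => by simp [V]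
  have hcard : V.card < d + 1 := by
    by_contra! hc
    obtain ⟨J, hJV, hJ⟩ := Finset.exists_subset_card_eq hc
    -- If `d + 1` coordinates vanished, `root_relation` would make all of them vanish.
    have hall : ∀ i, X i ∈ x.asHomogeneousIdeal.toIdeal := by
      intro i
      obtain ⟨c, hc⟩ := root_relation hz hJ (hρ J hJ) i
      have hsum : ∑ j, C (c j) * X j.1 ^ k ∈ x.asHomogeneousIdeal.toIdeal :=
        Ideal.sum_mem _ fun j _ => Ideal.mul_mem_left _ _
          (Ideal.pow_mem_of_mem _ ((hV _).mp (hJV j.2)) _ hk)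
      exact x.isPrime.mem_of_pow_mem _ ((Submodule.sub_mem_iff_left _ hsum).mp (hx _ hc))
    refine (lt_ker_constantCoeff x).not_ge fun f hf => ?_
    have h1 : f ∈ Ideal.span (X '' (Set.univ : Set (Fin (n + 1)))) := by
      rw [mem_ideal_span_X_image]
      intro m hm
      have : m ≠ 0 := by
        rintro rfl
        exact mem_support_iff.mp hm (by simpa [constantCoeff_eq] using hf)
      obtain ⟨i, hi⟩ := Finsupp.ne_iff.mp this
      exact ⟨i, trivial, hi⟩
    refine Ideal.span_le.mpr ?_ h1
    rintro _ ⟨i, -, rfl⟩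
    exact hall i
  obtain ⟨J, hVJ, hJ⟩ := Finset.exists_superset_card_eq (s := V) (n := d + 1) hcard.le
    (by simpa using hdn)
  obtain ⟨j₀, hj₀, hj₀V⟩ := Finset.exists_mem_notMem_of_card_lt_card (s := V) (t := J) (by omega)
  exact ⟨J, hJ, fun j hj => hVJ ((hV j).mpr hj), j₀, hj₀, fun h => hj₀V ((hV j₀).mpr h)⟩

theorem isRegularLocalRing_germs [FaithfulSMul (MvPolynomial (Fin (d + 1)) K) E]
    [Algebra.IsAlgebraic (MvPolynomial (Fin (d + 1)) K) E] (hdn : d ≤ n)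
    {ρ : Fin (n + 1) → Fin (d + 1) → K}
    (hρ : ∀ J : Finset (Fin (n + 1)), J.card = d + 1 → LinearIndependent K fun j : J => ρ j)
    {k : ℕ} (hk : (k : K) ≠ 0) {z : Fin (n + 1) → E}
    (hz : ∀ j, z j ^ k = algebraMap (MvPolynomial (Fin (d + 1)) K) E (linForm (ρ j)))
    {I : Ideal (MvPolynomial (Fin (n + 1)) K)} [I.IsPrime] (hI : ∀ f, aeval z f = 0 ↔ f ∈ I)
    {x : ProjSpace n K} (hIx : I ≤ x.asHomogeneousIdeal.toIdeal) :
    IsRegularLocalRing (ambientLocalRing x ⧸ germIdeal x I) := by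
  classical
  have hk0 : 0 < k := Nat.pos_of_ne_zero (by rintro rfl; simp at hk)
  obtain ⟨J, hJ, hVJ, j₀, hj₀, hj₀x⟩ := exists_coordinates hdn hρ hz hk0
    fun f hf => hIx ((hI f).mp hf)
  have hz0 : z j₀ ≠ 0 := fun h0 => hj₀x (hIx ((hI _).mp (by rw [aeval_X, h0])))
  let T := MvPolynomial {j // j ∈ J ∧ j ≠ j₀} K
  let O := ambientLocalRing x ⧸ germIdeal x I
  let δ : MvPolynomial (Fin (n + 1)) K →+* O :=
    (Ideal.Quotient.mk (germIdeal x I)).comp (dehomogenize x hj₀x)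
  let _ : Algebra T O := (δ.comp (rename Subtype.val).toRingHom).toAlgebra
  have hTO : ∀ f : T, algebraMap T O f = δ (rename Subtype.val f) := fun f => rfl
  have : (germIdeal x I).IsPrime := germIdeal_isPrime x hIx
  have : IsLocalRing O := IsLocalRing.of_surjective' (Ideal.Quotient.mk (germIdeal x I))
    Ideal.Quotient.mk_surjective
  -- Evaluation at the generic point sends the variables of `T` to algebraically independent ratios.
  have hinj : Function.Injective (algebraMap T O) := by
    obtain ⟨θ, hθ⟩ := exists_germ_eval x hj₀x hIx hI
    refine Function.Injective.of_comp (f := θ) ?_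
    have h1 := algebraicIndependent_ratio hz hJ (hρ J hJ) hj₀ hz0
    intro f g hfg
    refine h1 ?_
    have h2 : ∀ f : T, θ (algebraMap T O f) = aeval (fun j : {j // j ∈ J ∧ j ≠ j₀} =>
        z j / z j₀) f := fun f => by
      rw [hTO]
      refine (hθ _).trans ?_
      rw [aeval_rename]
      rfl
    exact (h2 f).symm.trans (hfg.trans (h2 g))
  have hδ0 : δ (X j₀) = 1 := by
    change Ideal.Quotient.mk _ (dehomogenize x hj₀x (X j₀)) = 1
    rw [dehomogenize_X_self, map_one]
  have hXJ : ∀ j ∈ J, δ (X j) ∈ (algebraMap T O).range := by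
    intro j hj
    by_cases h : j = j₀
    · rw [h, hδ0]; exact one_mem _
    · exact ⟨X ⟨j, hj, h⟩, by rw [hTO, rename_X]⟩
  have hC : ∀ a : K, δ (C a) ∈ (algebraMap T O).range := fun a => ⟨C a, by rw [hTO, rename_C]⟩
  have hkT : IsUnit (k : T) := by
    rw [← map_natCast (C : K →+* T)]
    exact (isUnit_iff_ne_zero.mpr hk).map C
  have hadj : ∀ f, δ f ∈ Algebra.adjoin T (Set.range fun i => δ (X i)) := by
    intro f
    induction f using MvPolynomial.induction_on with
    | C a => obtain ⟨t, ht⟩ := hC a; rw [← ht]; exact Subalgebra.algebraMap_mem _ t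
    | add p q hp hq => rw [map_add]; exact Subalgebra.add_mem _ hp hq
    | mul_X p i hp =>
      rw [map_mul]; exact Subalgebra.mul_mem _ hp (Algebra.subset_adjoin ⟨i, rfl⟩)
  refine isRegularLocalRing_of_roots (T := T) hinj hkT hk0 (fun i => δ (X i)) (fun i => ?_) ?_
  -- Vanishing coordinates belong to `J`, hence come from `T`; the others are units whose `k`-th
  -- power lies in `T` by the dehomogenized `root_relation`.
  · by_cases hi : X i ∈ x.asHomogeneousIdeal.toIdeal
    · exact Or.inl (hXJ i (hVJ i hi))
    · refine Or.inr ⟨(isUnit_dehomogenize x hj₀x (isHomogeneous_X K i) hi).map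
        (Ideal.Quotient.mk (germIdeal x I)), ?_⟩
      obtain ⟨c, hc⟩ := root_relation hz hJ (hρ J hJ) i
      have hhom : (X i ^ k - ∑ j, C (c j) * X j.1 ^ k :
          MvPolynomial (Fin (n + 1)) K).IsHomogeneous k := by
        refine (isHomogeneous_X_pow i k).sub (IsHomogeneous.sum _ _ _ fun j _ => ?_)
        simpa using (isHomogeneous_C _ (c j)).mul (isHomogeneous_X_pow j.1 k)
      have h1 : δ (X i ^ k - ∑ j, C (c j) * X j.1 ^ k) = 0 :=
        Ideal.Quotient.eq_zero_iff_mem.mpr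
          (dehomogenize_mem_germIdeal x hj₀x hhom ((hI _).mp hc))
      rw [map_sub, sub_eq_zero, map_pow, map_sum] at h1
      change δ (X i) ^ k ∈ (algebraMap T O).range
      rw [h1]
      refine sum_mem fun j _ => ?_
      rw [map_mul, map_pow]
      exact mul_mem (hC _) (pow_mem (hXJ j j.2) _)
  · intro o
    obtain ⟨a, rfl⟩ := Ideal.Quotient.mk_surjective o
    obtain ⟨f, g, hu, hfg⟩ := exists_dehomogenize_fraction x hj₀x a
    exact ⟨δ f, hadj f, δ g, hadj g, hu.map (Ideal.Quotient.mk (germIdeal x I)), by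
      rw [RingHom.comp_apply, RingHom.comp_apply, ← map_mul, hfg]⟩

end Nonsingular

end GeneralizedFermat

namespace GeneralizedFermat

open MvPolynomial hiding zeroLocus vanishingIdeal vanishingIdeal_anti_mono
open ProjectiveSpectrum

/-! ### Hyperplanes in general position -/

section GeneralPosition

variable {K : Type*} [Field K] {d : ℕ}

theorem mem_hyperplane {ρ v : Fin (d + 1) → K} : v ∈ hyperplane ρ ↔ ∑ i, ρ i * v i = 0 := by
  simp [hyperplane]

theorem hyperplane_smul {c : K} (hc : c ≠ 0) (ρ : Fin (d + 1) → K) :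
    hyperplane (c • ρ) = hyperplane ρ := by
  ext v
  simp [mem_hyperplane, mul_assoc, ← Finset.mul_sum, hc]

variable {ι : Type*} {ρ : ι → Fin (d + 1) → K}

theorem InGeneralPosition.eq_of_eq_smul (h : InGeneralPosition ρ) {i j : ι} {c : K}
    (hc : ρ j = c • ρ i) : i = j := by
  have hc0 : c ≠ 0 := by
    rintro rfl
    exact h.1 j (by rw [hc, zero_smul])
  refine h.2.1 ?_
  change hyperplane (ρ i) = hyperplane (ρ j)
  rw [hc, hyperplane_smul hc0]

/-- For `d ≥ 2` the hyperplanes meet only in zero, so the matrix of their coefficients is injective.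
For `d = 1` the condition on `s ≥ 3` hyperplanes is void and pairwise difference is used instead. -/
theorem InGeneralPosition.linearIndependent (hd : 1 ≤ d) (h : InGeneralPosition ρ) {J : Finset ι}
    (hJ : J.card = d + 1) : LinearIndependent K fun j : J => ρ j := by
  classical
  rcases hd.eq_or_lt with rfl | hd
  · obtain ⟨a, b, hab, rfl⟩ := Finset.card_eq_two.mp hJ
    have : LinearIndepOn K ρ {a, b} := by
      rw [LinearIndepOn.pair_iff ρ hab]
      intro s t hst
      have ht : t = 0 := by
        by_contra ht
        refine hab (h.eq_of_eq_smul (c := -(t⁻¹ * s)) ?_)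
        rw [neg_smul, mul_smul, eq_neg_iff_add_eq_zero, ← smul_right_injective _ ht |>.eq_iff]
        rw [smul_add, smul_inv_smul₀ ht, smul_zero]
        exact (add_comm _ _).trans hst
      subst ht
      rw [zero_smul, add_zero, smul_eq_zero] at hst
      exact ⟨hst.resolve_right (h.1 a), rfl⟩
    rwa [← Finset.coe_pair] at this
  · have h1 := h.2.2 J (by omega) hJ.le
    have hbot : (⨅ j ∈ J, hyperplane (ρ j)) = ⊥ := Submodule.finrank_eq_zero.mp (by omega)
    let e : Fin (d + 1) ≃ J := (Finset.equivFinOfCardEq hJ).symm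
    have hM : IsUnit (Matrix.of fun i : Fin (d + 1) => ρ (e i)) := by
      rw [← Matrix.mulVec_injective_iff_isUnit, ← Matrix.coe_mulVecLin, ← LinearMap.ker_eq_bot,
        eq_bot_iff, ← hbot]
      intro v hv
      simp only [Submodule.mem_iInf, mem_hyperplane]
      intro j hj
      have := congrFun (LinearMap.mem_ker.mp hv) (e.symm ⟨j, hj⟩)
      simpa [Matrix.mulVec, dotProduct] using this
    have := Matrix.linearIndependent_rows_iff_isUnit.mpr hM
    exact (linearIndependent_equiv e).mp this

end GeneralPosition

/-! ### The main theorem -/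

section Main

variable {K : Type*} [Field K] {d n : ℕ}

/-- The coefficient vectors of the linear forms `ℓ_j` with `x_j^k = ℓ_j(x_1^k, …, x_{d+1}^k)` on the
generalized Fermat variety. -/
def signedCoeff (Λ : Fin d → Fin (n - d - 1) → K) (j : Fin (n + 1)) : Fin (d + 1) → K :=
  (if (j : ℕ) < d + 1 then (1 : K) else -1) • hyperplaneCoeff (n := n) Λ j

theorem sign_ne_zero (j : Fin (n + 1)) : (if (j : ℕ) < d + 1 then (1 : K) else -1) ≠ 0 := by
  split_ifs <;> simp

theorem signedCoeff_inGeneralPosition {Λ : Fin d → Fin (n - d - 1) → K}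
    (hΛ : Λ ∈ parameterSpace K d n) : InGeneralPosition (signedCoeff (n := n) Λ) := by
  have h : ∀ j, hyperplane (signedCoeff Λ j) = hyperplane (hyperplaneCoeff (n := n) Λ j) :=
    fun j => hyperplane_smul (sign_ne_zero j) _
  obtain ⟨h1, h2, h3⟩ := hΛ
  exact ⟨fun j => smul_ne_zero (sign_ne_zero j) (h1 j), by simpa only [h] using h2,
    fun s hs hs' => by rw [iInf_congr fun j => iInf_congr fun _ => h j]; exact h3 s hs hs'⟩

/-- The inclusion of the first `d + 1` indices. -/
def firstIndices (hdn : d ≤ n) (i : Fin (d + 1)) : Fin (n + 1) := ⟨i, by omega⟩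

theorem linForm_signedCoeff_firstIndices (hdn : d ≤ n) (Λ : Fin d → Fin (n - d - 1) → K)
    (i : Fin (d + 1)) : linForm (signedCoeff Λ (firstIndices hdn i)) = X i := by
  have hi : ((firstIndices hdn i : Fin (n + 1)) : ℕ) < d + 1 := i.isLt
  rw [signedCoeff, hyperplaneCoeff, if_pos hi, dif_pos hi, one_smul]
  exact linForm_single i

theorem fermat_relation (hdn : d ≤ n) (k : ℕ) (Λ : Fin d → Fin (n - d - 1) → K) (i : Fin (n - d)) :
    X ⟨d + 1 + i, by omega⟩ ^ k -
      powSubst K k (firstIndices hdn) (linForm (signedCoeff Λ ⟨d + 1 + i, by omega⟩)) =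
      fermatEquation k Λ i := by
  have h : hyperplaneCoeff (n := n) Λ ⟨d + 1 + i, by omega⟩ = coeffRow Λ i := by
    rw [hyperplaneCoeff, dif_neg (by simp; omega)]
    congr 1
    ext
    simp
  rw [signedCoeff, h, if_neg (by simp; omega), linForm_smul, linForm, fermatEquation]
  simp [powSubst, firstIndices, algebraMap_eq, add_comm]

theorem fermat_relation_firstIndices (hdn : d ≤ n) (k : ℕ) (Λ : Fin d → Fin (n - d - 1) → K)
    (i : Fin (d + 1)) : X (firstIndices hdn i) ^ k -
      powSubst K k (firstIndices hdn) (linForm (signedCoeff Λ (firstIndices hdn i))) = 0 := by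
  rw [linForm_signedCoeff_firstIndices, powSubst, aeval_X, sub_self]

theorem fermatEquation_isHomogeneous (k : ℕ) (Λ : Fin d → Fin (n - d - 1) → K) (i : Fin (n - d)) :
    (fermatEquation k Λ i).IsHomogeneous k := by
  refine (IsHomogeneous.sum _ _ _ fun j _ => ?_).add (isHomogeneous_X_pow _ k)
  simpa using (isHomogeneous_C _ (coeffRow Λ i j)).mul (isHomogeneous_X_pow _ k)

end Main

end GeneralizedFermat

/-! ### The theorem -/

open MvPolynomial GeneralizedFermat in
theorem mainTheorem6 {K : Type*} [Field K] [IsAlgClosed K] (p : ℕ) [Fact p.Prime] [CharP K p]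
    (d n k : ℕ) (hd : 1 ≤ d) (hn : d + 1 ≤ n) (hk : 2 ≤ k) (hkp : k.Coprime p)
    (Λ : Fin d → Fin (n - d - 1) → K) (hΛ : Λ ∈ GeneralizedFermat.parameterSpace K d n) :
    IsIrreducible (GeneralizedFermat.fermatVariety (n := n) k Λ) ∧
    GeneralizedFermat.IsNonsingular (GeneralizedFermat.fermatVariety (n := n) k Λ) ∧
    topologicalKrullDim (GeneralizedFermat.fermatVariety (n := n) k Λ) = d ∧
    GeneralizedFermat.IsCompleteIntersectionOf (GeneralizedFermat.fermatVariety (n := n) k Λ)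
      (GeneralizedFermat.fermatEquation (n := n) k Λ) := by
  have hdn : d ≤ n := by omega
  have hkK : (k : K) ≠ 0 := fun h =>
    (Fact.out : p.Prime).one_lt.ne' (Nat.dvd_one.mp
      (hkp ▸ Nat.dvd_gcd ((CharP.cast_eq_zero_iff K p k).mp h) dvd_rfl))
  have hgp := signedCoeff_inGeneralPosition hΛ
  let s := firstIndices hdn
  have hs : ∀ i, linForm (signedCoeff Λ (s i)) = X i := linForm_signedCoeff_firstIndices hdn Λ
  let I := Ideal.span (Set.range (fermatEquation (n := n) k Λ))
  -- Of the `n + 1` relations the first `d + 1` are trivial and the others are the Fermat equations.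
  have hrel : ∀ J : Ideal (MvPolynomial (Fin (n + 1)) K),
      (∀ j, X j ^ k - powSubst K k s (linForm (signedCoeff Λ j)) ∈ J) ↔ I ≤ J := by
    intro J
    constructor
    · intro h
      rw [Ideal.span_le]
      rintro _ ⟨i, rfl⟩
      rw [← fermat_relation hdn]
      exact h _
    · intro h j
      by_cases hj : (j : ℕ) < d + 1
      · have := fermat_relation_firstIndices hdn k Λ ⟨j, hj⟩
        exact this ▸ J.zero_mem
      · have hji : j = ⟨d + 1 + (j - (d + 1) : ℕ), by omega⟩ := by ext; simp; omega
        have := fermat_relation hdn k Λ ⟨j - (d + 1), by omega⟩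
        rw [hji]
        exact this ▸ h (Ideal.subset_span ⟨_, rfl⟩)
  have hI := (hrel I).mpr le_rfl
  obtain ⟨E, _, _, _, _, _, _, z, hz, hzI⟩ := exists_generic_point hgp.1
    (fun i j c hc => hgp.eq_of_eq_smul hc) hkK hs hI fun J hJ => (hrel J).mp hJ
  have hIker : I = RingHom.ker (aeval z) := by
    ext f
    rw [RingHom.mem_ker, hzI]
  have hIp : I.IsPrime := hIker ▸ RingHom.ker_isPrime _
  have hIh : I.IsHomogeneous (grading n K) := by
    refine Ideal.homogeneous_span _ _ ?_
    rintro _ ⟨i, rfl⟩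
    exact ⟨k, fermatEquation_isHomogeneous k Λ i⟩
  have hmem : ∀ x, x ∈ fermatVariety (n := n) k Λ ↔ I ≤ x.asHomogeneousIdeal.toIdeal :=
    fun x => Ideal.span_le.symm
  -- `I` is itself a point of projective space: it omits `X 0`, because `z 0` is a root of a nonzero
  -- form.
  let x₀ : ProjSpace n K := ⟨⟨I, hIh⟩, hIp, fun h => by
    have h0 : X 0 ∈ I :=
      h (HomogeneousIdeal.mem_irrelevant_of_mem (grading n K) one_pos (isHomogeneous_X K _))
    rw [← hzI, aeval_X] at h0
    have h1 := hz 0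
    rw [h0, zero_pow (by omega), eq_comm, FaithfulSMul.algebraMap_eq_zero_iff] at h1
    exact (linForm_prime (hgp.1 0)).ne_zero h1⟩
  have hclosure : fermatVariety (n := n) k Λ = closure {x₀} := by
    ext x
    rw [hmem, ← ProjectiveSpectrum.le_iff_mem_closure]
    rfl
  have hvan : (ProjectiveSpectrum.vanishingIdeal (fermatVariety (n := n) k Λ)).toIdeal = I := by
    rw [hclosure, ProjectiveSpectrum.vanishingIdeal_closure,
      ProjectiveSpectrum.vanishingIdeal_singleton]
  have hirr : IsIrreducible (fermatVariety (n := n) k Λ) := by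
    rw [hclosure]
    exact isIrreducible_singleton.closure
  have hint := isIntegral_powSubst (by omega) hI
  have hdim : topologicalKrullDim (fermatVariety (n := n) k Λ) = d := by
    refine le_antisymm ?_ ?_
    · have := topologicalKrullDim_add_one_le hint hirr.nonempty fun x hx => (hmem x).mp hx
      rw [MvPolynomial.ringKrullDim_of_isNoetherianRing, ringKrullDim_eq_zero_of_field, zero_add,
        Nat.card_fin, Nat.cast_add, Nat.cast_one] at this
      exact ENat.WithBot.add_le_add_one_right_iff.mp this
    · refine (le_krullDim_of_isIntegral (by omega) hint ?_ x₀ rfl hmem).trans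
        (krullDim_le_topologicalKrullDim _)
      -- The contraction of `I` vanishes because `K[t]` embeds in `E`.
      rw [eq_bot_iff]
      intro f hf
      have h1 := (hzI _).mpr (Ideal.mem_comap.mp hf)
      have h2 := (aeval_powSubst hs hz f).symm.trans h1
      exact (FaithfulSMul.algebraMap_eq_zero_iff _ _).mp h2
  refine ⟨hirr, fun x hx => ?_, hdim, fun i => ⟨k, fermatEquation_isHomogeneous k Λ i⟩, hvan, ?_⟩
  · change IsRegularLocalRing (ambientLocalRing x ⧸ germIdeal x
      (ProjectiveSpectrum.vanishingIdeal (fermatVariety (n := n) k Λ)).toIdeal)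
    rw [hvan]
    exact isRegularLocalRing_germs hdn (fun J hJ => hgp.linearIndependent hd hJ) hkK hz hzI
      ((hmem x).mp hx)
  · rw [hdim, Fintype.card_fin]
    exact_mod_cast congrArg (Nat.cast : ℕ → WithBot ℕ∞) (Nat.add_sub_cancel' hdn)
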